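/- Let $\alpha\ge 1/2$ and $\lambda>0$, and write $\gamma_{\alpha,\lambda}$ for the gamma law with density $\frac{\lambda^\alpha}{\Gamma(\alpha)}u^{\alpha-1}e^{-\lambda u}$, $u>0$. Let $X$ be an almost surely positive random variable with $\mathbb E[X^{\alpha+4}]<\infty$ and $\mathbb E[X]=\alpha/\lambda$. (The law of $X$ is not assumed to have a density.) For $\tau\in(0,1)$ define the gamma smart path $$X_\tau=(1-\tau)\,G+\tau\,Y_\tau ,$$ where, given $X=x$, $K$ is a Poisson random variable with parameter $x\lambda\tau/(1-\tau)$; given $X=x$ and $K=k$, $Y_\tau$ is $0$ if $k=0$ and a gamma random variable with shape $k$ and rate $\lambda\tau/(1-\tau)$ if $k\ge 1$; and $G$ has law $\gamma_{\alpha,\lambda}$ and is independent of $(X,K,Y_\tau)$. For a positive random variable $Y$ with locally absolutely continuous density $f_Y$ on $(0,\infty)$, put $\rho_Y(u)=\partial_u\log f_Y(u)$ and $$J_{st,\gamma}(Y)=\mathbb E\Big[Y\Big(\rho_Y(Y)-\frac{\alpha-1}{Y}+\lambda\Big)^2\Big]\in[0,\infty]$$ (with $J_{st,\gamma}(Y)=\infty$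 if there is no such density), and let $D(\cdot\,\|\,\cdot)\in[0,\infty]$ be the relative entropy (Kullback–Leibler divergence) of laws, equal to $+\infty$ when the first law is not absolutely continuous with respect to the second. Then $$D(X\,\|\,\gamma_{\alpha,\lambda})=\int_0^1\frac{1}{\lambda\tau}\,J_{st,\gamma}(X_\tau)\,d\tau ,$$ as an identity in $[0,\infty]$ (both sides may be $+\infty$). -/

import Mathlib

open MeasureTheory ProbabilityTheory Set
open scoped ENNReal

noncomputable section

namespace GammaSmartPath

/-- The law of `Y(τ, X, λ)` given that the Poisson variable takes the value `k`: the gamma law with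
shape `k` and rate `r`, with the convention that it is the unit mass at `0` for `k = 0`. -/
def gammaOrZero (r : ℝ) (k : ℕ) : Measure ℝ :=
  if k = 0 then Measure.dirac 0 else gammaMeasure k r

/-- The kernel `k ↦ gammaOrZero r k`. -/
def gammaKernel (r : ℝ) : Kernel ℕ ℝ where
  toFun := gammaOrZero r
  measurable' := measurable_from_nat

/-- The kernel sending `x` to the Poisson law of parameter `x * c` (meant for `x, c > 0`). -/
def poissonKernel (c : ℝ) : Kernel ℝ ℕ where
  toFun x := poissonMeasure (x * c).toNNReal
  measurable' := by
    refine Measure.measurable_of_measurable_coe _ fun s _ => ?_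
    simp only [poissonMeasure, Measure.sum_apply _ (MeasurableSet.of_discrete (s := s)),
      Measure.smul_apply]
    fun_prop

/-- The law of `Y(τ, X, λ)` when `X` has law `μ`: draw `x` from `μ`, then `k` from the Poisson law of
parameter `x λ τ / (1 - τ)`, then a gamma variable of shape `k` and rate `λ τ / (1 - τ)`
(`0` if `k = 0`). -/
def lawY (lam τ : ℝ) (μ : Measure ℝ) : Measure ℝ :=
  (μ.bind (poissonKernel (lam * τ / (1 - τ)))).bind (gammaKernel (lam * τ / (1 - τ)))

/-- The law of the gamma smart path `X_τ = (1 - τ) γ(α, λ) + τ Y(τ, X, λ)`, where the gamma variable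
`γ(α, λ)` is independent of `Y(τ, X, λ)` and `X` has law `μ`. -/
def law (α lam τ : ℝ) (μ : Measure ℝ) : Measure ℝ :=
  ((gammaMeasure α lam).map (fun z => (1 - τ) * z)).conv ((lawY lam τ μ).map (fun y => τ * y))

/-- `f` is a nonnegative, locally absolutely continuous Lebesgue density on `(0, ∞)` of the
measure `ν` (which is then carried by `(0, ∞)`). -/
structure IsRegularDensity (f : ℝ → ℝ) (ν : Measure ℝ) : Prop where
  nonneg : ∀ u, 0 < u → 0 ≤ f u
  absCont : ∀ a b, 0 < a → a ≤ b → AbsolutelyContinuousOnInterval f a b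
  eq_withDensity : ν = (volume.restrict (Ioi 0)).withDensity (fun u => ENNReal.ofReal (f u))

/-- The score `ρ(u) = ∂ᵤ (log f(u))` of a density `f`. -/
def score (f : ℝ → ℝ) (u : ℝ) : ℝ := deriv (fun v => Real.log (f v)) u

/-- The score `(α - 1) / u - λ` of the gamma law with shape `α` and rate `λ`, for `u > 0`. -/
def gammaScore (α lam u : ℝ) : ℝ := (α - 1) / u - lam

/-- `E[Y (ρ_f(Y) - ρ_{α,λ}(Y))²]` for `Y` of law `ν`, in terms of the density `f` of `ν`. -/
def fisherOfDensity (α lam : ℝ) (f : ℝ → ℝ) (ν : Measure ℝ) : ℝ≥0∞ :=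
  ∫⁻ u, ENNReal.ofReal (u * (score f u - gammaScore α lam u) ^ 2) ∂ν

/-- The standardized Fisher information of `ν` with respect to the gamma law. A regular density of
`ν` is unique on `(0, ∞)` when it exists, so that the infimum is then over one value
(`relFisherInfo_eq`); it is `∞` when `ν` has no regular density. -/
def relFisherInfo (α lam : ℝ) (ν : Measure ℝ) : ℝ≥0∞ :=
  ⨅ (f : ℝ → ℝ) (_ : IsRegularDensity f ν), fisherOfDensity α lam f ν

theorem IsRegularDensity.continuousOn {f : ℝ → ℝ} {ν : Measure ℝ} (hf : IsRegularDensity f ν) :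
    ContinuousOn f (Ioi 0) := by
  intro u hu
  have hu : (0 : ℝ) < u := hu
  have h := (hf.absCont (u / 2) (u + 1) (by linarith) (by linarith)).continuousOn
  rw [uIcc_of_le (by linarith)] at h
  exact (h.continuousAt (Icc_mem_nhds (by linarith) (by linarith))).continuousWithinAt

theorem IsRegularDensity.eqOn {f g : ℝ → ℝ} {ν : Measure ℝ} [IsFiniteMeasure ν]
    (hf : IsRegularDensity f ν) (hg : IsRegularDensity g ν) : EqOn f g (Ioi 0) := by
  have mf : AEMeasurable (fun u => ENNReal.ofReal (f u)) (volume.restrict (Ioi 0)) :=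
    (hf.continuousOn.aemeasurable measurableSet_Ioi).ennreal_ofReal
  have mg : AEMeasurable (fun u => ENNReal.ofReal (g u)) (volume.restrict (Ioi 0)) :=
    (hg.continuousOn.aemeasurable measurableSet_Ioi).ennreal_ofReal
  have fin : ∫⁻ u, ENNReal.ofReal (f u) ∂(volume.restrict (Ioi 0)) ≠ ∞ := by
    have := measure_ne_top ν univ
    rwa [hf.eq_withDensity, withDensity_apply _ MeasurableSet.univ, Measure.restrict_univ] at this
  have h : (fun u => ENNReal.ofReal (f u)) =ᵐ[volume.restrict (Ioi 0)]
      (fun u => ENNReal.ofReal (g u)) :=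
    (withDensity_eq_iff mf mg fin).1 (hf.eq_withDensity.symm.trans hg.eq_withDensity)
  refine Measure.eqOn_open_of_ae_eq (μ := volume) ?_ isOpen_Ioi hf.continuousOn hg.continuousOn
  filter_upwards [h, ae_restrict_mem measurableSet_Ioi] with u hu h0
  exact (ENNReal.ofReal_eq_ofReal_iff (hf.nonneg u h0) (hg.nonneg u h0)).1 hu

theorem relFisherInfo_eq {α lam : ℝ} {f : ℝ → ℝ} {ν : Measure ℝ} [IsFiniteMeasure ν]
    (hf : IsRegularDensity f ν) : relFisherInfo α lam ν = fisherOfDensity α lam f ν := by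
  refine le_antisymm (iInf₂_le f hf) (le_iInf₂ fun g hg => le_of_eq ?_)
  have h0 : ∀ᵐ u ∂ν, u ∈ Ioi (0 : ℝ) := by
    rw [hf.eq_withDensity]
    exact (withDensity_absolutelyContinuous _ _).ae_le (ae_restrict_mem measurableSet_Ioi)
  refine lintegral_congr_ae ?_
  filter_upwards [h0] with u hu
  have : (fun v => Real.log (f v)) =ᶠ[nhds u] (fun v => Real.log (g v)) := by
    filter_upwards [isOpen_Ioi.mem_nhds hu] with v hv
    rw [hf.eqOn hg hv]
  simp only [score, this.deriv_eq]

end GammaSmartPath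

end

/-!
Put `r = λτ/(1-τ)`, so that `τ = r/(r+λ)` and `dτ/(λτ) = dr/(r(r+λ))`; the time `τ ∈ (0,1)` becomes
`r ∈ (0,∞)`. By the convolution and scaling rules for gamma laws, the law of `X_τ` is the Poisson
mixture of gammas `pathLaw`: draw `x` from the law `μ` of `X`, then `k` from the Poisson law of
parameter `rx`, then a gamma variable of shape `α + k` and rate `r + λ` (`law_eq_pathLaw`). Its
density `relDensity` with respect to `γ_{α,λ}` is therefore

`h(r,u) = ((r+λ)/λ)^α e^{-ru} ∫ e^{-rx} B_α(r(r+λ)xu) dμ(x)`, `B_β(z) = ∑ Γ(β) z^k / (k! Γ(β+k))`,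

and the equation `z B'' + α B' = B` gives the backward equation of the Laguerre operator,
`r(r+λ) ∂_r h = -(u ∂_u²h + (α - λu) ∂_u h)` (`hasDerivAt_relDensity_time`).

Multiplying by `log h` times the gamma density turns the backward equation into a balance law for
the entropy density `h log h - h + 1`, with the nonnegative production `u (∂_u h)² / (h r(r+λ))`.
For `α ≥ 1/2` one has `B_α(z) ≤ e^{2√z}`, so that the moment of order `α + 4` makes the flux vanish
at infinity, locally uniformly in `r`; at `u = 0` it vanishes with `u^α`. Integration over
`[a,b] × (0,∞)` is the de Bruijn identity `pathEntropy_eq_add`: the relative entropy at time `b` is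
that at time `a` plus the integral of the production.

It remains to identify the ends of the path. As `r → 0` the entropy tends to `0` by dominated
convergence (`tendsto_pathEntropy_zero`). The entropy never exceeds `D(X‖γ_{α,λ})`: the transition
kernel is symmetric, so that it preserves `γ_{α,λ}`, and entropy decreases under kernels
(`pathEntropy_le_klDiv`). Conversely, the path converges weakly to `μ` as `r → ∞`, which is seen on
Laplace transforms, and the relative entropy is bounded by the entropies along the path because it
is a supremum of functionals which are continuous for weak convergence
(`klDiv_le_of_pathEntropy_le`). Hence `D(X‖γ_{α,λ})` is the total production
(`lintegral_production_eq_klDiv`), and the production at time `r` is `J_{st,γ}(X_τ) / (r(r+λ))`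
(`relFisherInfo_pathLaw`). No step subtracts infinities, so the identity holds in `[0,∞]`.
-/

noncomputable section

namespace GammaSmartPath

open Filter Topology InformationTheory
open scoped BoundedContinuousFunction

/-! ### The law of the path as a Poisson mixture of gamma laws -/

section

/-- The exponential moments of the gamma law. -/
lemma lintegral_exp_gammaMeasure {a s t : ℝ} (ha : 0 < a) (hs : 0 < s) (ht : t < s) :
    ∫⁻ x, ENNReal.ofReal (Real.exp (t * x)) ∂(gammaMeasure a s) =
      ENNReal.ofReal ((s / (s - t)) ^ a) := by
  have hst : 0 < s - t := sub_pos.2 ht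
  have key : ∀ x, (gammaPDF a s x) * ENNReal.ofReal (Real.exp (t * x)) =
      ENNReal.ofReal ((s / (s - t)) ^ a) * gammaPDF a (s - t) x := by
    intro x
    rcases lt_or_ge x 0 with hx | hx
    · simp [gammaPDF_of_neg hx]
    · rw [gammaPDF_of_nonneg hx, gammaPDF_of_nonneg hx, ← ENNReal.ofReal_mul (by positivity),
        ← ENNReal.ofReal_mul (by positivity), Real.div_rpow hs.le hst.le,
        show -((s - t) * x) = -(s * x) + t * x by ring, Real.exp_add]
      have : (s - t) ^ a ≠ 0 := (Real.rpow_pos_of_pos hst a).ne'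
      congr 1
      field_simp
  rw [gammaMeasure, lintegral_withDensity_eq_lintegral_mul₀ (by unfold gammaPDF; fun_prop)
    (by fun_prop)]
  simp only [Pi.mul_apply, key]
  rw [lintegral_const_mul' _ _ ENNReal.ofReal_ne_top, lintegral_gammaPDF_eq_one ha hst, mul_one]

/-- A probability measure on the line with exponential moments on a half-line `(-∞, s)`, `s > 0`, is
determined by these moments: its complex moment generating function is analytic on a half-plane
that contains the imaginary axis. -/
lemma ext_of_lintegral_exp {μ ν : Measure ℝ} [IsProbabilityMeasure μ] [IsProbabilityMeasure ν]
    {s : ℝ} (hs : 0 < s)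
    (hfin : ∀ t < s, ∫⁻ x, ENNReal.ofReal (Real.exp (t * x)) ∂μ ≠ ∞)
    (h : ∀ t < s, ∫⁻ x, ENNReal.ofReal (Real.exp (t * x)) ∂μ =
      ∫⁻ x, ENNReal.ofReal (Real.exp (t * x)) ∂ν) : μ = ν := by
  have hint : ∀ (ρ : Measure ℝ), (∀ t < s, ∫⁻ x, ENNReal.ofReal (Real.exp (t * x)) ∂ρ ≠ ∞) →
      Iio s ⊆ integrableExpSet id ρ := by
    intro ρ hρ t ht
    refine (lintegral_ofReal_ne_top_iff_integrable (by fun_prop) ?_).1 (hρ t ht)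
    exact ae_of_all _ fun x => (Real.exp_pos _).le
  have hμ := hint μ hfin
  have hν := hint ν fun t ht => h t ht ▸ hfin t ht
  have hmgf : ∀ t < s, mgf id μ t = mgf id ν t := by
    intro t ht
    simp only [mgf, id]
    rw [integral_eq_lintegral_of_nonneg_ae (ae_of_all _ fun x => (Real.exp_pos _).le)
      (by fun_prop), h t ht, integral_eq_lintegral_of_nonneg_ae
      (ae_of_all _ fun x => (Real.exp_pos _).le) (by fun_prop)]
  have hsub : ∀ (ρ : Measure ℝ), Iio s ⊆ integrableExpSet id ρ →
      {z : ℂ | z.re < s} ⊆ {z | z.re ∈ interior (integrableExpSet id ρ)} := by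
    intro ρ hρ z hz
    exact interior_maximal hρ isOpen_Iio hz
  have hX : AnalyticOnNhd ℂ (complexMGF id μ) {z : ℂ | z.re < s} :=
    analyticOnNhd_complexMGF.mono (hsub μ hμ)
  have hY : AnalyticOnNhd ℂ (complexMGF id ν) {z : ℂ | z.re < s} :=
    analyticOnNhd_complexMGF.mono (hsub ν hν)
  have hpre : IsPreconnected {z : ℂ | z.re < s} := (convex_halfSpace_re_lt s).isPreconnected
  have heq : EqOn (complexMGF id μ) (complexMGF id ν) {z : ℂ | z.re < s} := by
    refine AnalyticOnNhd.eqOn_of_preconnected_of_frequently_eq hX hY hpre (z₀ := 0)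
      (by simpa using hs) ?_
    have h0 : Tendsto (fun n : ℕ => ((-(1 / ((n : ℝ) + 1)) : ℝ) : ℂ)) atTop (𝓝[≠] 0) := by
      refine tendsto_nhdsWithin_iff.2 ⟨?_, Eventually.of_forall fun n => ?_⟩
      · have := (tendsto_one_div_add_atTop_nhds_zero_nat (𝕜 := ℝ)).neg
        rw [neg_zero] at this
        exact_mod_cast (Complex.continuous_ofReal.tendsto (0 : ℝ)).comp this
      · have : (0 : ℝ) < 1 / ((n : ℝ) + 1) := by positivity
        exact Complex.ofReal_ne_zero.2 (by linarith)
    refine h0.frequently (Frequently.of_forall fun n => ?_)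
    rw [complexMGF_ofReal, complexMGF_ofReal, hmgf]
    have : (0 : ℝ) < 1 / ((n : ℝ) + 1) := by positivity
    linarith
  refine Measure.ext_of_charFun (funext fun t => ?_)
  rw [← complexMGF_id_mul_I, ← complexMGF_id_mul_I]
  exact heq (by simpa using hs)

/-- The gamma laws of a given rate form a convolution semigroup in the shape. -/
lemma gammaMeasure_conv {a b s : ℝ} (ha : 0 < a) (hb : 0 < b) (hs : 0 < s) :
    (gammaMeasure a s).conv (gammaMeasure b s) = gammaMeasure (a + b) s := by
  have := isProbabilityMeasure_gammaMeasure ha hs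
  have := isProbabilityMeasure_gammaMeasure hb hs
  have := isProbabilityMeasure_gammaMeasure (add_pos ha hb) hs
  have key : ∀ t < s, ∫⁻ x, ENNReal.ofReal (Real.exp (t * x))
      ∂((gammaMeasure a s).conv (gammaMeasure b s)) = ENNReal.ofReal ((s / (s - t)) ^ (a + b)) := by
    intro t ht
    have hst : 0 < s - t := sub_pos.2 ht
    rw [Measure.lintegral_conv (by fun_prop)]
    simp_rw [mul_add, Real.exp_add, ENNReal.ofReal_mul (Real.exp_pos _).le]
    simp_rw [lintegral_const_mul' _ _ ENNReal.ofReal_ne_top, lintegral_exp_gammaMeasure hb hs ht]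
    rw [lintegral_mul_const' _ _ ENNReal.ofReal_ne_top, lintegral_exp_gammaMeasure ha hs ht,
      ← ENNReal.ofReal_mul (by positivity), Real.rpow_add (by positivity)]
  refine ext_of_lintegral_exp hs (fun t ht => ?_) (fun t ht => ?_)
  · rw [key t ht]; exact ENNReal.ofReal_ne_top
  · rw [key t ht, lintegral_exp_gammaMeasure (add_pos ha hb) hs ht]

lemma gammaMeasure_map_mul {a s c : ℝ} (ha : 0 < a) (hs : 0 < s) (hc : 0 < c) :
    (gammaMeasure a s).map (fun x => c * x) = gammaMeasure a (s / c) := by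
  have := isProbabilityMeasure_gammaMeasure ha hs
  have := isProbabilityMeasure_gammaMeasure ha (div_pos hs hc)
  have : IsProbabilityMeasure ((gammaMeasure a s).map (fun x => c * x)) :=
    Measure.isProbabilityMeasure_map (by fun_prop)
  have key : ∀ t < s / c, ∫⁻ x, ENNReal.ofReal (Real.exp (t * x))
      ∂((gammaMeasure a s).map (fun x => c * x)) =
        ENNReal.ofReal ((s / c / (s / c - t)) ^ a) := by
    intro t ht
    have ht' : t * c < s := (lt_div_iff₀ hc).1 ht
    have h1 : s - t * c ≠ 0 := (sub_pos.2 ht').ne'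
    rw [lintegral_map (by fun_prop) (by fun_prop)]
    simp_rw [← mul_assoc]
    rw [lintegral_exp_gammaMeasure ha hs ht']
    congr 2
    rw [show s / c - t = (s - t * c) / c by field_simp]
    field_simp
  refine ext_of_lintegral_exp (div_pos hs hc) (fun t ht => ?_) (fun t ht => ?_)
  · rw [key t ht]; exact ENNReal.ofReal_ne_top
  · rw [key t ht, lintegral_exp_gammaMeasure ha (div_pos hs hc) ht]

/-- The kernel sending `k` to the gamma law of shape `α + k` and rate `s`: the law of `X_τ` given
that the Poisson variable takes the value `k`, when `s = λ / (1 - τ)`. -/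
def mixKernel (α s : ℝ) : Kernel ℕ ℝ where
  toFun k := gammaMeasure (α + k) s
  measurable' := measurable_from_nat

lemma isMarkovKernel_mixKernel {α s : ℝ} (hα : 0 < α) (hs : 0 < s) :
    IsMarkovKernel (mixKernel α s) :=
  ⟨fun k => isProbabilityMeasure_gammaMeasure (by positivity) hs⟩

lemma isMarkovKernel_poissonKernel (c : ℝ) : IsMarkovKernel (poissonKernel c) :=
  ⟨fun x => by change IsProbabilityMeasure (poissonMeasure (x * c).toNNReal); infer_instance⟩

lemma isMarkovKernel_gammaKernel {r : ℝ} (hr : 0 < r) : IsMarkovKernel (gammaKernel r) := by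
  refine ⟨fun k => ?_⟩
  change IsProbabilityMeasure (gammaOrZero r k)
  unfold gammaOrZero
  split_ifs with hk
  · infer_instance
  · exact isProbabilityMeasure_gammaMeasure (Nat.cast_pos.2 (Nat.pos_of_ne_zero hk)) hr

/-- The law of the gamma smart path in the parameter `r = λ τ / (1 - τ)`. -/
def pathLaw (α lam r : ℝ) (μ : Measure ℝ) : Measure ℝ :=
  (μ.bind (poissonKernel r)).bind (mixKernel α (r + lam))

/-- Given the value of the Poisson variable, the two summands of the path add up to a single gamma
random variable. -/
lemma gammaMeasure_conv_gammaOrZero {α lam τ : ℝ} (hα : 0 < α) (hlam : 0 < lam) (h0 : 0 < τ)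
    (h1 : τ < 1) (k : ℕ) :
    ((gammaMeasure α lam).map (fun z => (1 - τ) * z)).conv
      ((gammaOrZero (lam * τ / (1 - τ)) k).map (fun y => τ * y)) =
        gammaMeasure (α + k) (lam * τ / (1 - τ) + lam) := by
  have h1' : 0 < 1 - τ := sub_pos.2 h1
  have hs : lam * τ / (1 - τ) + lam = lam / (1 - τ) := by field_simp; ring
  rw [gammaMeasure_map_mul hα hlam h1', hs]
  have := isProbabilityMeasure_gammaMeasure hα (div_pos hlam h1')
  unfold gammaOrZero
  split_ifs with hk
  · rw [Measure.map_dirac' (by fun_prop), mul_zero, Measure.conv_dirac_zero, hk, Nat.cast_zero,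
      add_zero]
  · have hk' : (0 : ℝ) < k := Nat.cast_pos.2 (Nat.pos_of_ne_zero hk)
    rw [gammaMeasure_map_mul hk' (by positivity) h0,
      show lam * τ / (1 - τ) / τ = lam / (1 - τ) by field_simp,
      gammaMeasure_conv hα hk' (by positivity)]

lemma law_eq_pathLaw {α lam τ : ℝ} (hα : 0 < α) (hlam : 0 < lam) (h0 : 0 < τ) (h1 : τ < 1)
    (μ : Measure ℝ) [IsProbabilityMeasure μ] :
    law α lam τ μ = pathLaw α lam (lam * τ / (1 - τ)) μ := by
  have h1' : 0 < 1 - τ := sub_pos.2 h1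
  have := isProbabilityMeasure_gammaMeasure hα hlam
  have := isMarkovKernel_poissonKernel (lam * τ / (1 - τ))
  have : IsMarkovKernel (gammaKernel (lam * τ / (1 - τ))) :=
    isMarkovKernel_gammaKernel (by positivity)
  have : IsProbabilityMeasure (lawY lam τ μ) := by unfold lawY; infer_instance
  ext A hA
  have hg : Measurable fun p : ℝ × ℝ => A.indicator (1 : ℝ → ℝ≥0∞) (p.1 + p.2) :=
    (measurable_one.indicator hA).comp (by fun_prop)
  rw [← lintegral_indicator_one hA, law, Measure.lintegral_conv (measurable_one.indicator hA),
    lintegral_lintegral_swap hg.aemeasurable]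
  have hφ : Measurable fun y => ∫⁻ x, A.indicator (1 : ℝ → ℝ≥0∞) (x + y)
      ∂((gammaMeasure α lam).map (fun z => (1 - τ) * z)) := hg.lintegral_prod_left
  have hφ' := hφ.comp (measurable_const_mul τ)
  rw [lintegral_map hφ (by fun_prop), lawY]
  change ∫⁻ a, ((fun y => ∫⁻ x, A.indicator (1 : ℝ → ℝ≥0∞) (x + y)
    ∂((gammaMeasure α lam).map (fun z => (1 - τ) * z))) ∘ fun y => τ * y) a ∂_ = _
  rw [Measure.lintegral_bind (Kernel.aemeasurable _)
      hφ'.aemeasurable,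
    pathLaw, Measure.bind_apply hA (Kernel.aemeasurable _)]
  refine lintegral_congr fun k => ?_
  have : IsProbabilityMeasure (gammaOrZero (lam * τ / (1 - τ)) k) :=
    (isMarkovKernel_gammaKernel (r := lam * τ / (1 - τ)) (by positivity)).isProbabilityMeasure k
  change _ = gammaMeasure (α + k) _ A
  rw [← gammaMeasure_conv_gammaOrZero hα hlam h0 h1 k, ← lintegral_indicator_one hA,
    Measure.lintegral_conv (measurable_one.indicator hA), lintegral_lintegral_swap hg.aemeasurable,
    lintegral_map hφ (by fun_prop)]
  rfl

end

/-! ### A normalised modified Bessel function -/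

section

/-- The coefficients `Γ(β) / (k! Γ(β + k))` of the hypergeometric series `₀F₁(; β; z)`. -/
def besCoeff (β : ℝ) (k : ℕ) : ℝ := Real.Gamma β / (k.factorial * Real.Gamma (β + k))

/-- The hypergeometric function `₀F₁(; β; z)`, a modified Bessel function in the variable `√z`
up to a power. -/
def bes (β z : ℝ) : ℝ := ∑' k, besCoeff β k * z ^ k

lemma besCoeff_pos {β : ℝ} (hβ : 0 < β) (k : ℕ) : 0 < besCoeff β k := by
  have := Real.Gamma_pos_of_pos hβ
  have : 0 < Real.Gamma (β + k) := Real.Gamma_pos_of_pos (by positivity)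
  unfold besCoeff
  positivity

lemma besCoeff_zero {β : ℝ} (hβ : 0 < β) : besCoeff β 0 = 1 := by
  have := (Real.Gamma_pos_of_pos hβ).ne'
  simp [besCoeff, this]

lemma besCoeff_succ {β : ℝ} (hβ : 0 < β) (k : ℕ) :
    besCoeff β (k + 1) = besCoeff β k / ((k + 1) * (β + k)) := by
  have hk : 0 < β + k := by positivity
  have h2 := (Real.Gamma_pos_of_pos hk).ne'
  have h3 := hk.ne'
  unfold besCoeff
  rw [Nat.factorial_succ, Nat.cast_succ, ← add_assoc, Real.Gamma_add_one h3]
  push_cast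
  field_simp

lemma besCoeff_add_one {β : ℝ} (hβ : 0 < β) (k : ℕ) :
    besCoeff (β + 1) k = besCoeff β k * (β / (β + k)) := by
  have hk : 0 < β + k := by positivity
  have h2 := (Real.Gamma_pos_of_pos hk).ne'
  have h3 := hk.ne'
  unfold besCoeff
  rw [add_right_comm, Real.Gamma_add_one h3, Real.Gamma_add_one hβ.ne']
  field_simp

/-- The bound holds with equality for `β = 1/2`, by the duplication formula; the ratio of two
successive coefficients decreases in `β`. -/
lemma besCoeff_le {β : ℝ} (hβ : 1 / 2 ≤ β) (k : ℕ) :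
    besCoeff β k ≤ 4 ^ k / (2 * k).factorial := by
  have h0 : 0 < β := by linarith
  induction k with
  | zero => simp [besCoeff_zero h0]
  | succ k ih =>
    rw [besCoeff_succ h0, show 2 * (k + 1) = 2 * k + 1 + 1 by ring, Nat.factorial_succ,
      Nat.factorial_succ]
    push_cast
    calc besCoeff β k / ((k + 1) * (β + k))
        ≤ (4 ^ k / (2 * k).factorial) / ((k + 1) * (1 / 2 + k)) := by gcongr
      _ = _ := by field_simp; ring

lemma norm_besCoeff_mul_pow_le {β : ℝ} (hβ : 1 / 2 ≤ β) (z : ℝ) (k : ℕ) :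
    ‖besCoeff β k * z ^ k‖ ≤ (2 * Real.sqrt |z|) ^ (2 * k) / (2 * k).factorial := by
  rw [norm_mul, norm_pow, Real.norm_eq_abs, Real.norm_eq_abs,
    abs_of_pos (besCoeff_pos (by linarith) k), pow_mul, mul_pow, Real.sq_sqrt (abs_nonneg z),
    mul_pow, mul_div_right_comm]
  norm_num only
  gcongr
  exact besCoeff_le hβ k

lemma summable_bes {β : ℝ} (hβ : 1 / 2 ≤ β) (z : ℝ) :
    Summable fun k => besCoeff β k * z ^ k :=
  Summable.of_norm_bounded (Real.hasSum_cosh _).summable (norm_besCoeff_mul_pow_le hβ z)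

lemma hasSum_bes {β : ℝ} (hβ : 1 / 2 ≤ β) (z : ℝ) :
    HasSum (fun k => besCoeff β k * z ^ k) (bes β z) := (summable_bes hβ z).hasSum

/-- The growth bound of `₀F₁(; β; ·)` for `β ≥ 1/2`, by comparison with the case `β = 1/2`, which is
`cosh (2 √z)`. -/
lemma abs_bes_le {β : ℝ} (hβ : 1 / 2 ≤ β) (z : ℝ) : |bes β z| ≤ Real.exp (2 * Real.sqrt |z|) := by
  have h1 : ‖bes β z‖ ≤ Real.cosh (2 * Real.sqrt |z|) :=
    tsum_of_norm_bounded (Real.hasSum_cosh _) (norm_besCoeff_mul_pow_le hβ z)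
  refine h1.trans ?_
  rw [Real.cosh_eq]
  have : Real.exp (-(2 * Real.sqrt |z|)) ≤ Real.exp (2 * Real.sqrt |z|) :=
    Real.exp_le_exp.2 (by have := Real.sqrt_nonneg |z|; linarith)
  linarith

lemma one_le_bes {β z : ℝ} (hβ : 1 / 2 ≤ β) (hz : 0 ≤ z) : 1 ≤ bes β z := by
  have h0 : 0 < β := by linarith
  have := (summable_bes hβ z).le_tsum 0 fun k _ =>
    mul_nonneg (besCoeff_pos h0 k).le (pow_nonneg hz k)
  simpa [besCoeff_zero h0, bes] using this

lemma bes_zero {β : ℝ} (hβ : 0 < β) : bes β 0 = 1 := by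
  rw [bes, tsum_eq_single 0 (fun k hk => by simp [hk])]
  simp [besCoeff_zero hβ]

lemma bes_add_one_le {β z : ℝ} (hβ : 1 / 2 ≤ β) (hz : 0 ≤ z) : bes (β + 1) z ≤ bes β z := by
  have h0 : 0 < β := by linarith
  refine (summable_bes (by linarith) z).tsum_le_tsum (fun k => ?_) (summable_bes hβ z)
  rw [besCoeff_add_one h0]
  have : β / (β + k) ≤ 1 := (div_le_one (by positivity)).2 (by simp)
  exact mul_le_mul_of_nonneg_right (mul_le_of_le_one_right (besCoeff_pos h0 k).le this)
    (pow_nonneg hz k)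

lemma hasDerivAt_bes {β : ℝ} (hβ : 1 / 2 ≤ β) (z : ℝ) :
    HasDerivAt (bes β) (bes (β + 1) z / β) z := by
  have h0 : 0 < β := by linarith
  have hco : ∀ k : ℕ, besCoeff β (k + 1) * ((k + 1 : ℕ) : ℝ) = besCoeff (β + 1) k / β := by
    intro k
    rw [besCoeff_succ h0, besCoeff_add_one h0]
    have : β + k ≠ 0 := by positivity
    push_cast
    field_simp
  have hβ1 : 1 / 2 ≤ β + 1 := by linarith
  have hsum : ∀ y, HasSum (fun k : ℕ => besCoeff β k * (k * y ^ (k - 1))) (bes (β + 1) y / β) := by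
    intro y
    rw [← hasSum_nat_add_iff' 1]
    simp only [Finset.range_one, Finset.sum_singleton, Nat.cast_zero, zero_mul, mul_zero, sub_zero,
      Nat.add_sub_cancel]
    have e : (fun k : ℕ => besCoeff β (k + 1) * (((k + 1 : ℕ) : ℝ) * y ^ k)) =
        fun k => besCoeff (β + 1) k * y ^ k / β := by
      funext k
      rw [← mul_assoc, hco]
      ring
    rw [e]
    exact (hasSum_bes hβ1 y).div_const β
  have := hasDerivAt_tsum_of_isPreconnected (g := fun (k : ℕ) y => besCoeff β k * y ^ k)
    (g' := fun k y => besCoeff β k * (k * y ^ (k - 1)))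
    (u := fun k : ℕ => besCoeff β k * (k * (|z| + 1) ^ (k - 1)))
    (t := Metric.ball 0 (|z| + 1)) (hsum (|z| + 1)).summable Metric.isOpen_ball
    (convex_ball _ _).isPreconnected (y₀ := z) (y := z)
    (fun k y _ => (hasDerivAt_pow k y).const_mul _) ?_ (by simp) (summable_bes hβ z) (by simp)
  · rwa [(hsum z).tsum_eq] at this
  · intro k y hy
    have hy : |y| < |z| + 1 := by simpa using hy
    rw [norm_mul, norm_mul, norm_pow, Real.norm_eq_abs, abs_of_pos (besCoeff_pos h0 k),
      Real.norm_natCast, Real.norm_eq_abs]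
    have := (besCoeff_pos h0 k).le
    gcongr

lemma continuous_bes {β : ℝ} (hβ : 1 / 2 ≤ β) : Continuous (bes β) :=
  continuous_iff_continuousAt.2 fun z => (hasDerivAt_bes hβ z).continuousAt

/-- The hypergeometric equation `z y'' + β y' = y` of `₀F₁(; β; ·)`, with the derivatives expressed
through the functions of parameters `β + 1` and `β + 2`. -/
lemma bes_eq {β : ℝ} (hβ : 1 / 2 ≤ β) (z : ℝ) :
    bes β z = z * bes (β + 1 + 1) z / (β * (β + 1)) + bes (β + 1) z := by
  have h0 : 0 < β := by linarith
  have h1 := (hasSum_nat_add_iff' 1).2 (hasSum_bes hβ z)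
  have h2 := (hasSum_nat_add_iff' 1).2 (hasSum_bes (show 1 / 2 ≤ β + 1 by linarith) z)
  have h3 := ((hasSum_bes (show 1 / 2 ≤ β + 1 + 1 by linarith) z).mul_left z).div_const
    (β * (β + 1))
  have h4 := h3.add h2
  have : ∀ k : ℕ, z * (besCoeff (β + 1 + 1) k * z ^ k) / (β * (β + 1)) +
      besCoeff (β + 1) (k + 1) * z ^ (k + 1) = besCoeff β (k + 1) * z ^ (k + 1) := by
    intro k
    have e1 : β + k ≠ 0 := by positivity
    have e2 : β + 1 + k ≠ 0 := by positivity
    have e3 : β + (k + 1) ≠ 0 := by positivity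
    rw [besCoeff_add_one (by linarith : 0 < β + 1), besCoeff_add_one h0 (k + 1),
      besCoeff_add_one h0 k, besCoeff_succ h0]
    push_cast
    field_simp
    ring
  simp only [this] at h4
  have h5 := h1.unique h4
  simp only [Finset.range_one, Finset.sum_singleton, pow_zero, mul_one, besCoeff_zero h0,
    besCoeff_zero (by linarith : 0 < β + 1)] at h5
  linarith

end

/-! ### The density of the path with respect to the gamma law -/

section

/-- The transition density of the gamma smart path from `x` to `u`, in the parameter
`r = λ τ / (1 - τ)` and relative to the gamma law of shape `α` and rate `λ`. -/
def transDensity (α lam r x u : ℝ) : ℝ :=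
  ((r + lam) / lam) ^ α * (Real.exp (-(r * x)) * Real.exp (-(r * u)) *
    bes α (r * (r + lam) * x * u))

lemma transDensity_symm (α lam r x u : ℝ) :
    transDensity α lam r x u = transDensity α lam r u x := by
  unfold transDensity
  rw [mul_right_comm (r * (r + lam)) x u, mul_comm (Real.exp (-(r * x)))]

lemma transDensity_pos {α lam r x u : ℝ} (hα : 1 / 2 ≤ α) (hlam : 0 < lam) (hr : 0 < r)
    (hx : 0 ≤ x) (hu : 0 ≤ u) : 0 < transDensity α lam r x u := by
  have : 0 < bes α (r * (r + lam) * x * u) :=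
    lt_of_lt_of_le one_pos (one_le_bes hα (by positivity))
  unfold transDensity
  positivity

lemma measurable_transDensity {α : ℝ} (hα : 1 / 2 ≤ α) (lam r : ℝ) :
    Measurable fun p : ℝ × ℝ => transDensity α lam r p.1 p.2 := by
  have := (continuous_bes hα).measurable
  unfold transDensity
  fun_prop

lemma lintegral_poissonKernel {r x : ℝ} (hr : 0 ≤ r) (hx : 0 ≤ x) (f : ℕ → ℝ≥0∞) :
    ∫⁻ k, f k ∂(poissonKernel r x) =
      ∑' k : ℕ, ENNReal.ofReal (Real.exp (-(x * r)) * (x * r) ^ k / k.factorial) * f k := by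
  change ∫⁻ k, f k ∂(poissonMeasure (x * r).toNNReal) = _
  rw [poissonMeasure, lintegral_sum_measure]
  refine tsum_congr fun k => ?_
  rw [lintegral_smul_measure, lintegral_dirac, Real.coe_toNNReal _ (by positivity), smul_eq_mul]

/-- The series of Poisson weights times gamma densities is that of `bes`, since the weights
`1 / (k! Γ(α + k))` occur in both. -/
lemma tsum_poisson_mul_gammaPDF {α lam r x u : ℝ} (hα : 1 / 2 ≤ α) (hlam : 0 < lam) (hr : 0 < r)
    (hx : 0 ≤ x) (hu : 0 < u) :
    ∑' k : ℕ, ENNReal.ofReal (Real.exp (-(x * r)) * (x * r) ^ k / k.factorial) *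
      gammaPDF (α + k) (r + lam) u =
        gammaPDF α lam u * ENNReal.ofReal (transDensity α lam r x u) := by
  have hα0 : 0 < α := by linarith
  have hG := Real.Gamma_pos_of_pos hα0
  have h1 : ∀ k : ℕ, Real.exp (-(x * r)) * (x * r) ^ k / k.factorial *
      gammaPDFReal (α + k) (r + lam) u = gammaPDFReal α lam u * (((r + lam) / lam) ^ α *
        (Real.exp (-(r * x)) * Real.exp (-(r * u)) *
          (besCoeff α k * (r * (r + lam) * x * u) ^ k))) := by
    intro k
    have hk : 0 < Real.Gamma (α + k) := Real.Gamma_pos_of_pos (by positivity)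
    have hl := Real.rpow_pos_of_pos hlam α
    simp only [gammaPDFReal, if_pos hu.le, besCoeff]
    rw [Real.div_rpow (by positivity) hlam.le, show α + k - 1 = (α - 1) + (k : ℕ) by ring,
      Real.rpow_add hu, Real.rpow_add (by positivity), Real.rpow_natCast, Real.rpow_natCast,
      show -((r + lam) * u) = -(lam * u) + -(r * u) by ring, Real.exp_add, mul_comm x r]
    simp only [mul_pow]
    field_simp
  have h2 := (((hasSum_bes hα (r * (r + lam) * x * u)).mul_left
    (Real.exp (-(r * x)) * Real.exp (-(r * u)))).mul_left (((r + lam) / lam) ^ α)).mul_left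
      (gammaPDFReal α lam u)
  simp only [← h1] at h2
  have h3 : ∀ k : ℕ, 0 ≤ Real.exp (-(x * r)) * (x * r) ^ k / k.factorial := fun k => by positivity
  have h4 : ∀ k : ℕ, 0 ≤ gammaPDFReal (α + k) (r + lam) u := fun k =>
    gammaPDFReal_nonneg (by positivity) (by positivity) u
  simp only [gammaPDF]
  rw [← ENNReal.ofReal_mul (gammaPDFReal_nonneg hα0 hlam u), transDensity, ← h2.tsum_eq,
    ENNReal.ofReal_tsum_of_nonneg (fun k => mul_nonneg (h3 k) (h4 k)) h2.summable]
  exact tsum_congr fun k => (ENNReal.ofReal_mul (h3 k)).symm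

lemma measurable_gammaPDF (a s : ℝ) : Measurable (gammaPDF a s) := by unfold gammaPDF; fun_prop

/-- The gamma law does not charge `(-∞, 0]`. -/
lemma gammaMeasure_ae_pos (a s : ℝ) : ∀ᵐ u ∂(gammaMeasure a s), 0 < u := by
  rw [gammaMeasure, ae_withDensity_iff (measurable_gammaPDF a s)]
  filter_upwards [Measure.ae_ne volume (0 : ℝ)] with u hu hne
  by_contra h
  exact hne (gammaPDF_of_neg (lt_of_le_of_ne (not_lt.1 h) hu))

/-- Integrals over the half-line weighted by the gamma density. -/
lemma lintegral_gammaMeasure {a s : ℝ} (f : ℝ → ℝ≥0∞)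
    (hf : AEMeasurable f (volume.restrict (Ioi 0))) :
    ∫⁻ u, f u ∂(gammaMeasure a s) =
      ∫⁻ u in Ioi (0 : ℝ), ENNReal.ofReal (gammaPDFReal a s u) * f u := by
  have h : (gammaMeasure a s).restrict (Ioi 0) = gammaMeasure a s :=
    Measure.restrict_eq_self_of_ae_mem (gammaMeasure_ae_pos a s)
  rw [← h, gammaMeasure, restrict_withDensity measurableSet_Ioi,
    lintegral_withDensity_eq_lintegral_mul₀ (measurable_gammaPDF a s).aemeasurable hf]
  rfl

lemma pathLaw_eq_withDensity {α lam r : ℝ} (hα : 1 / 2 ≤ α) (hlam : 0 < lam) (hr : 0 < r)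
    {μ : Measure ℝ} [IsProbabilityMeasure μ] (hμ : ∀ᵐ x ∂μ, 0 < x) :
    pathLaw α lam r μ = (gammaMeasure α lam).withDensity
      fun u => ∫⁻ x, ENNReal.ofReal (transDensity α lam r x u) ∂μ := by
  have hα0 : 0 < α := by linarith
  have := isProbabilityMeasure_gammaMeasure hα0 hlam
  have hm := (measurable_transDensity hα lam r).ennreal_ofReal
  ext A hA
  rw [pathLaw, Measure.bind_apply hA (Kernel.aemeasurable _),
    Measure.lintegral_bind (Kernel.aemeasurable _) (Kernel.measurable_coe _ hA).aemeasurable,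
    withDensity_apply _ hA, ← lintegral_lintegral_swap hm.aemeasurable]
  refine lintegral_congr_ae ?_
  filter_upwards [hμ] with x hx
  rw [lintegral_poissonKernel hr.le hx.le]
  have hmx : Measurable fun u => ENNReal.ofReal (transDensity α lam r x u) :=
    hm.comp measurable_prodMk_left
  have h1 : ∀ k : ℕ, mixKernel α (r + lam) k A = ∫⁻ u in A, gammaPDF (α + k) (r + lam) u :=
    fun k => withDensity_apply _ hA
  simp only [h1]
  simp_rw [← lintegral_const_mul' _ _ ENNReal.ofReal_ne_top]
  rw [← lintegral_tsum fun k => ((measurable_gammaPDF _ _).const_mul _).aemeasurable, gammaMeasure,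
    restrict_withDensity hA, lintegral_withDensity_eq_lintegral_mul _ (measurable_gammaPDF _ _) hmx]
  refine lintegral_congr_ae (ae_restrict_of_ae ?_)
  filter_upwards [Measure.ae_ne volume (0 : ℝ)] with u hu
  rcases lt_or_gt_of_ne hu with hu | hu
  · simp [gammaPDF_of_neg hu]
  · rw [tsum_poisson_mul_gammaPDF hα hlam hr hx.le hu]
    rfl

lemma isProbabilityMeasure_pathLaw {α lam r : ℝ} (hα : 0 < α) (hlam : 0 < lam) (hr : 0 < r)
    (μ : Measure ℝ) [IsProbabilityMeasure μ] : IsProbabilityMeasure (pathLaw α lam r μ) := by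
  have := isMarkovKernel_poissonKernel r
  have := isMarkovKernel_mixKernel hα (by positivity : 0 < r + lam)
  unfold pathLaw
  infer_instance

/-- The transition density has total mass one with respect to the gamma law. -/
lemma lintegral_transDensity {α lam r x : ℝ} (hα : 1 / 2 ≤ α) (hlam : 0 < lam) (hr : 0 < r)
    (hx : 0 < x) :
    ∫⁻ u, ENNReal.ofReal (transDensity α lam r x u) ∂(gammaMeasure α lam) = 1 := by
  have h := pathLaw_eq_withDensity hα hlam hr (μ := Measure.dirac x)
    ((ae_dirac_iff measurableSet_Ioi).2 hx)
  have := isProbabilityMeasure_pathLaw (by linarith : 0 < α) hlam hr (Measure.dirac x)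
  have h1 := measure_univ (μ := pathLaw α lam r (Measure.dirac x))
  rw [h, withDensity_apply _ MeasurableSet.univ, Measure.restrict_univ] at h1
  simpa using h1

/-- The gamma law is invariant: the transition density is symmetric. -/
lemma pathLaw_gammaMeasure {α lam r : ℝ} (hα : 1 / 2 ≤ α) (hlam : 0 < lam) (hr : 0 < r) :
    pathLaw α lam r (gammaMeasure α lam) = gammaMeasure α lam := by
  have := isProbabilityMeasure_gammaMeasure (by linarith : 0 < α) hlam
  rw [pathLaw_eq_withDensity hα hlam hr (gammaMeasure_ae_pos α lam)]
  conv_rhs => rw [← withDensity_one (μ := gammaMeasure α lam)]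
  refine withDensity_congr_ae ?_
  filter_upwards [gammaMeasure_ae_pos α lam] with u hu
  simp_rw [transDensity_symm α lam r _ u]
  exact lintegral_transDensity hα hlam hr hu

/-- The data processing inequality along the path. -/
lemma klDiv_pathLaw_le {α lam r : ℝ} (hα : 1 / 2 ≤ α) (hlam : 0 < lam) (hr : 0 < r)
    (μ : Measure ℝ) [IsProbabilityMeasure μ] :
    InformationTheory.klDiv (pathLaw α lam r μ) (gammaMeasure α lam) ≤
      InformationTheory.klDiv μ (gammaMeasure α lam) := by
  have := isProbabilityMeasure_gammaMeasure (by linarith : 0 < α) hlam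
  have := isMarkovKernel_poissonKernel r
  have := isMarkovKernel_mixKernel (by linarith : 0 < α) (by positivity : 0 < r + lam)
  conv_lhs => rw [← pathLaw_gammaMeasure hα hlam hr]
  exact (InformationTheory.klDiv_comp_right_le _ _ (mixKernel α (r + lam))).trans
    (InformationTheory.klDiv_comp_right_le _ _ (poissonKernel r))

end

/-! ### Differentiation under the integral sign -/

section

/-- The integrand of `lap`. -/
def lapKernel (lam β : ℝ) (j : ℕ) (r u x : ℝ) : ℝ :=
  x ^ j * (Real.exp (-(r * x)) * bes β (r * (r + lam) * x * u))

/-- The mixed moments `E[X ^ j exp (-r X) ₀F₁(; β; r (r + λ) X u)]` for `X` of law `μ`. All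
derivatives of the density of the path are combinations of them. -/
def lap (lam : ℝ) (μ : Measure ℝ) (β : ℝ) (j : ℕ) (r u : ℝ) : ℝ := ∫ x, lapKernel lam β j r u x ∂μ

lemma two_sqrt_mul_le {a b : ℝ} (ha : 0 ≤ a) (hb : 0 ≤ b) :
    2 * Real.sqrt (a * b) ≤ a / 2 + 2 * b := by
  rw [Real.sqrt_mul ha]
  nlinarith [Real.sq_sqrt ha, Real.sq_sqrt hb, sq_nonneg (Real.sqrt a - 2 * Real.sqrt b)]

lemma abs_lapKernel_le {lam β r x : ℝ} (hlam : 0 < lam) (hβ : 1 / 2 ≤ β) (hr : 0 < r) (hx : 0 ≤ x)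
    (j : ℕ) (u : ℝ) :
    |lapKernel lam β j r u x| ≤
      x ^ j * Real.exp (-(r * x) + 2 * Real.sqrt ((r * x) * ((r + lam) * |u|))) := by
  have h := abs_bes_le hβ (r * (r + lam) * x * u)
  rw [abs_mul (r * (r + lam) * x) u, abs_of_nonneg (by positivity : 0 ≤ r * (r + lam) * x),
    show r * (r + lam) * x * |u| = (r * x) * ((r + lam) * |u|) by ring] at h
  rw [lapKernel, abs_mul, abs_mul, abs_of_nonneg (pow_nonneg hx j), Real.abs_exp, Real.exp_add]
  gcongr

/-- The integrand of `lap` is bounded in `x`, locally uniformly in the parameters. -/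
lemma abs_lapKernel_le_of_le {lam β r r₁ r₂ u U x : ℝ} (hlam : 0 < lam) (hβ : 1 / 2 ≤ β)
    (h₁ : 0 < r₁) (hr₁ : r₁ ≤ r) (hr₂ : r ≤ r₂) (hu : |u| ≤ U) (hx : 0 ≤ x) (j : ℕ) :
    |lapKernel lam β j r u x| ≤ j.factorial * (2 / r₁) ^ j * Real.exp (2 * ((r₂ + lam) * U)) := by
  have hr : 0 < r := h₁.trans_le hr₁
  refine (abs_lapKernel_le hlam hβ hr hx j u).trans ?_
  have h1 := two_sqrt_mul_le (a := r * x) (b := (r + lam) * |u|) (by positivity) (by positivity)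
  have hr₂' : 0 ≤ r₂ + lam := by linarith
  have h2 : (r + lam) * |u| ≤ (r₂ + lam) * U := by gcongr
  have h3 : -(r * x) + 2 * Real.sqrt ((r * x) * ((r + lam) * |u|)) ≤
      -(r₁ * x / 2) + 2 * ((r₂ + lam) * U) := by
    have : r₁ * x ≤ r * x := by gcongr
    linarith
  have h4 := Real.pow_div_factorial_le_exp (r₁ * x / 2) (by positivity) j
  have h5 : x ^ j * Real.exp (-(r₁ * x / 2)) ≤ j.factorial * (2 / r₁) ^ j := by
    rw [Real.exp_neg, ← div_eq_mul_inv, div_le_iff₀ (Real.exp_pos _)]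
    rw [div_le_iff₀ (by positivity)] at h4
    calc x ^ j = (2 / r₁) ^ j * (r₁ * x / 2) ^ j := by
          rw [← mul_pow]; congr 1; field_simp
      _ ≤ (2 / r₁) ^ j * (Real.exp (r₁ * x / 2) * j.factorial) := by gcongr
      _ = _ := by ring
  calc x ^ j * Real.exp (-(r * x) + 2 * Real.sqrt ((r * x) * ((r + lam) * |u|)))
      ≤ x ^ j * Real.exp (-(r₁ * x / 2) + 2 * ((r₂ + lam) * U)) := by gcongr
    _ = x ^ j * Real.exp (-(r₁ * x / 2)) * Real.exp (2 * ((r₂ + lam) * U)) := by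
        rw [Real.exp_add, mul_assoc]
    _ ≤ _ := by gcongr

lemma continuous_lapKernel {β : ℝ} (hβ : 1 / 2 ≤ β) (lam : ℝ) (j : ℕ) :
    Continuous fun q : ℝ × ℝ × ℝ => lapKernel lam β j q.1 q.2.1 q.2.2 := by
  have := continuous_bes hβ
  unfold lapKernel
  fun_prop

lemma measurable_lapKernel {β : ℝ} (hβ : 1 / 2 ≤ β) (lam : ℝ) (j : ℕ) (r u : ℝ) :
    Measurable (lapKernel lam β j r u) :=
  ((continuous_lapKernel hβ lam j).comp
    (by fun_prop : Continuous fun x : ℝ => (r, u, x))).measurable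

variable {μ : Measure ℝ} [IsProbabilityMeasure μ]

lemma integrable_lapKernel {lam β r : ℝ} (hlam : 0 < lam) (hβ : 1 / 2 ≤ β) (hr : 0 < r)
    (hμ : ∀ᵐ x ∂μ, 0 < x) (j : ℕ) (u : ℝ) : Integrable (lapKernel lam β j r u) μ := by
  refine Integrable.of_bound (measurable_lapKernel hβ lam j r u).aestronglyMeasurable
    (j.factorial * (2 / r) ^ j * Real.exp (2 * ((r + lam) * |u|))) ?_
  filter_upwards [hμ] with x hx
  exact abs_lapKernel_le_of_le hlam hβ hr le_rfl le_rfl le_rfl hx.le j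

lemma lap_nonneg {μ : Measure ℝ} {lam β r u : ℝ} (hlam : 0 < lam) (hβ : 1 / 2 ≤ β) (hr : 0 < r)
    (hμ : ∀ᵐ x ∂μ, 0 < x) (j : ℕ) (hu : 0 ≤ u) : 0 ≤ lap lam μ β j r u := by
  refine integral_nonneg_of_ae ?_
  filter_upwards [hμ] with x hx
  have : 0 ≤ bes β (r * (r + lam) * x * u) := zero_le_one.trans (one_le_bes hβ (by positivity))
  change 0 ≤ x ^ j * _
  positivity

lemma lap_add_one_le {lam β r u : ℝ} (hlam : 0 < lam) (hβ : 1 / 2 ≤ β) (hr : 0 < r)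
    (hμ : ∀ᵐ x ∂μ, 0 < x) (j : ℕ) (hu : 0 ≤ u) :
    lap lam μ (β + 1) j r u ≤ lap lam μ β j r u := by
  refine integral_mono_ae (integrable_lapKernel hlam (by linarith) hr hμ j u)
    (integrable_lapKernel hlam hβ hr hμ j u) ?_
  filter_upwards [hμ] with x hx
  have := bes_add_one_le hβ (by positivity : 0 ≤ r * (r + lam) * x * u)
  change x ^ j * _ ≤ x ^ j * _
  gcongr

lemma continuousOn_lap {lam β : ℝ} (hlam : 0 < lam) (hβ : 1 / 2 ≤ β) (hμ : ∀ᵐ x ∂μ, 0 < x)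
    (j : ℕ) : ContinuousOn (fun p : ℝ × ℝ => lap lam μ β j p.1 p.2) {p | 0 < p.1} := by
  rintro ⟨r, u⟩ (hr : 0 < r)
  refine ContinuousAt.continuousWithinAt ?_
  refine continuousAt_of_dominated
    (bound := fun _ => j.factorial * (2 / (r / 2)) ^ j *
      Real.exp (2 * ((2 * r + lam) * (|u| + 1)))) ?_ ?_ (integrable_const _) ?_
  · exact Eventually.of_forall fun p => (measurable_lapKernel hβ lam j p.1 p.2).aestronglyMeasurable
  · have e1 : ∀ᶠ p : ℝ × ℝ in 𝓝 (r, u), r / 2 < p.1 :=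
      continuousAt_fst.eventually_const_lt (by change r / 2 < r; linarith)
    have e2 : ∀ᶠ p : ℝ × ℝ in 𝓝 (r, u), p.1 < 2 * r :=
      continuousAt_fst.eventually_lt_const (by change r < 2 * r; linarith)
    have e3 : ∀ᶠ p : ℝ × ℝ in 𝓝 (r, u), |p.2| < |u| + 1 :=
      (continuousAt_snd.abs).eventually_lt_const (by change |u| < |u| + 1; linarith)
    filter_upwards [e1, e2, e3] with p h1 h2 h3
    filter_upwards [hμ] with x hx
    exact abs_lapKernel_le_of_le hlam hβ (by positivity) h1.le h2.le h3.le hx.le j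
  · refine ae_of_all _ fun x => ?_
    exact ((continuous_lapKernel hβ lam j).comp
      (by fun_prop : Continuous fun p : ℝ × ℝ => (p.1, p.2, x))).continuousAt

lemma hasDerivAt_lap_space {lam β r : ℝ} (hlam : 0 < lam) (hβ : 1 / 2 ≤ β) (hr : 0 < r)
    (hμ : ∀ᵐ x ∂μ, 0 < x) (j : ℕ) (u : ℝ) :
    HasDerivAt (lap lam μ β j r) (r * (r + lam) / β * lap lam μ (β + 1) (j + 1) r u) u := by
  have hβ1 : 1 / 2 ≤ β + 1 := by linarith
  have hd := (hasDerivAt_integral_of_dominated_loc_of_deriv_le (μ := μ)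
    (F := fun u x => lapKernel lam β j r u x)
    (F' := fun u x => r * (r + lam) / β * lapKernel lam (β + 1) (j + 1) r u x) (x₀ := u)
    (s := Metric.ball u 1)
    (bound := fun _ => |r * (r + lam) / β| * ((j + 1).factorial * (2 / r) ^ (j + 1) *
      Real.exp (2 * ((r + lam) * (|u| + 1)))))
    (Metric.ball_mem_nhds _ one_pos)
    (Eventually.of_forall fun u => (measurable_lapKernel hβ lam j r u).aestronglyMeasurable)
    (integrable_lapKernel hlam hβ hr hμ j u)
    ((measurable_lapKernel hβ1 lam (j + 1) r u).const_mul _).aestronglyMeasurable ?_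
    (integrable_const _) ?_).2
  · rwa [integral_const_mul] at hd
  · filter_upwards [hμ] with x hx v hv
    rw [norm_mul, Real.norm_eq_abs, Real.norm_eq_abs]
    refine mul_le_mul_of_nonneg_left (abs_lapKernel_le_of_le hlam hβ1 hr le_rfl le_rfl ?_ hx.le _)
      (abs_nonneg _)
    have h1 : |v - u| < 1 := hv
    have h2 := abs_add_le (v - u) u
    rw [sub_add_cancel] at h2
    linarith
  · refine ae_of_all _ fun x v _ => ?_
    have h1 : HasDerivAt (fun v => r * (r + lam) * x * v) (r * (r + lam) * x * 1) v :=
      (hasDerivAt_id v).const_mul _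
    have h2 := (((hasDerivAt_bes hβ (r * (r + lam) * x * v)).comp v h1).const_mul
      (Real.exp (-(r * x)))).const_mul (x ^ j)
    refine h2.congr_deriv ?_
    simp only [lapKernel]
    ring

lemma hasDerivAt_lap_time {lam β r : ℝ} (hlam : 0 < lam) (hβ : 1 / 2 ≤ β) (hr : 0 < r)
    (hμ : ∀ᵐ x ∂μ, 0 < x) (j : ℕ) (u : ℝ) :
    HasDerivAt (fun r => lap lam μ β j r u) (-lap lam μ β (j + 1) r u +
      (2 * r + lam) * u / β * lap lam μ (β + 1) (j + 1) r u) r := by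
  have hβ1 : 1 / 2 ≤ β + 1 := by linarith
  have hd := (hasDerivAt_integral_of_dominated_loc_of_deriv_le (μ := μ)
    (F := fun r x => lapKernel lam β j r u x)
    (F' := fun r x => -lapKernel lam β (j + 1) r u x +
      (2 * r + lam) * u / β * lapKernel lam (β + 1) (j + 1) r u x) (x₀ := r)
    (s := Ioo (r / 2) (2 * r))
    (bound := fun _ => ((j + 1).factorial * (2 / (r / 2)) ^ (j + 1) *
      Real.exp (2 * ((2 * r + lam) * |u|))) + (2 * (2 * r) + lam) * |u| / β *
        ((j + 1).factorial * (2 / (r / 2)) ^ (j + 1) * Real.exp (2 * ((2 * r + lam) * |u|))))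
    (Ioo_mem_nhds (by linarith) (by linarith))
    (Eventually.of_forall fun r => (measurable_lapKernel hβ lam j r u).aestronglyMeasurable)
    (integrable_lapKernel hlam hβ hr hμ j u)
    ((measurable_lapKernel hβ lam (j + 1) r u).neg.add
      ((measurable_lapKernel hβ1 lam (j + 1) r u).const_mul _)).aestronglyMeasurable ?_
    (integrable_const _) ?_).2
  · rwa [integral_add (f := fun x => -lapKernel lam β (j + 1) r u x)
      (integrable_lapKernel hlam hβ hr hμ (j + 1) u).neg
      ((integrable_lapKernel hlam hβ1 hr hμ (j + 1) u).const_mul _), integral_neg,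
      integral_const_mul] at hd
  · filter_upwards [hμ] with x hx v hv
    have hv0 : 0 < v := by linarith [hv.1]
    refine (norm_add_le _ _).trans ?_
    rw [norm_neg, norm_mul, Real.norm_eq_abs, Real.norm_eq_abs, Real.norm_eq_abs, abs_div, abs_mul,
      abs_of_pos (by linarith : 0 < β), abs_of_pos (by positivity : 0 < 2 * v + lam)]
    have := hv.2.le
    gcongr
    · exact abs_lapKernel_le_of_le hlam hβ (by positivity) hv.1.le hv.2.le le_rfl hx.le _
    · exact abs_lapKernel_le_of_le hlam hβ1 (by positivity) hv.1.le hv.2.le le_rfl hx.le _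
  · refine ae_of_all _ fun x v _ => ?_
    have h0 : HasDerivAt (fun v => v * (v + lam) * x * u)
        ((1 * (v + lam) + v * 1) * x * u) v :=
      ((((hasDerivAt_id v).mul ((hasDerivAt_id v).add_const lam))).mul_const x).mul_const u
    have h1 : HasDerivAt (fun v => Real.exp (-(v * x))) (Real.exp (-(v * x)) * -(1 * x)) v :=
      ((hasDerivAt_id v).mul_const x).neg.exp
    have h2 := (h1.mul ((hasDerivAt_bes hβ (v * (v + lam) * x * u)).comp v h0)).const_mul (x ^ j)
    refine h2.congr_deriv ?_
    simp only [lapKernel, Function.comp]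
    ring

/-- The integrated form of the hypergeometric equation. -/
lemma lap_eq {lam β r : ℝ} (hlam : 0 < lam) (hβ : 1 / 2 ≤ β) (hr : 0 < r)
    (hμ : ∀ᵐ x ∂μ, 0 < x) (j : ℕ) (u : ℝ) :
    lap lam μ β j r u = r * (r + lam) * u / (β * (β + 1)) * lap lam μ (β + 1 + 1) (j + 1) r u +
      lap lam μ (β + 1) j r u := by
  have h1 : 1 / 2 ≤ β + 1 := by linarith
  have h2 : 1 / 2 ≤ β + 1 + 1 := by linarith
  simp only [lap]
  rw [← integral_const_mul,
    ← integral_add ((integrable_lapKernel hlam h2 hr hμ (j + 1) u).const_mul _)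
    (integrable_lapKernel hlam h1 hr hμ j u)]
  refine integral_congr_ae (ae_of_all _ fun x => ?_)
  simp only [lapKernel]
  rw [bes_eq hβ]
  ring

/-! ### The density of the path and its derivatives -/

/-- The density of the path with respect to the gamma law, in the parameter `r = λ τ / (1 - τ)`. -/
def relDensity (α lam : ℝ) (μ : Measure ℝ) (r u : ℝ) : ℝ :=
  ((r + lam) / lam) ^ α * (Real.exp (-(r * u)) * lap lam μ α 0 r u)

/-- The first space derivative of `relDensity`. -/
def relDensity' (α lam : ℝ) (μ : Measure ℝ) (r u : ℝ) : ℝ :=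
  ((r + lam) / lam) ^ α * (Real.exp (-(r * u)) *
    (-r * lap lam μ α 0 r u + r * (r + lam) / α * lap lam μ (α + 1) 1 r u))

/-- The second space derivative of `relDensity`. -/
def relDensity'' (α lam : ℝ) (μ : Measure ℝ) (r u : ℝ) : ℝ :=
  ((r + lam) / lam) ^ α * (Real.exp (-(r * u)) *
    (r ^ 2 * lap lam μ α 0 r u - 2 * r * (r * (r + lam) / α) * lap lam μ (α + 1) 1 r u +
      r * (r + lam) / α * (r * (r + lam) / (α + 1)) * lap lam μ (α + 1 + 1) 2 r u))

variable {α lam : ℝ}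

lemma relDensity_eq_integral (α lam : ℝ) (μ : Measure ℝ) (r u : ℝ) :
    relDensity α lam μ r u = ∫ x, transDensity α lam r x u ∂μ := by
  unfold relDensity lap transDensity lapKernel
  rw [← integral_const_mul, ← integral_const_mul]
  refine integral_congr_ae (ae_of_all _ fun x => ?_)
  ring

lemma integrable_transDensity (hα : 1 / 2 ≤ α) (hlam : 0 < lam) {r : ℝ} (hr : 0 < r)
    (hμ : ∀ᵐ x ∂μ, 0 < x) (u : ℝ) : Integrable (fun x => transDensity α lam r x u) μ := by
  have := ((integrable_lapKernel hlam hα hr hμ 0 u).const_mul (Real.exp (-(r * u)))).const_mul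
    (((r + lam) / lam) ^ α)
  refine this.congr (ae_of_all _ fun x => ?_)
  simp only [transDensity, lapKernel]
  ring

lemma pathLaw_eq_withDensity_relDensity (hα : 1 / 2 ≤ α) (hlam : 0 < lam) {r : ℝ} (hr : 0 < r)
    (hμ : ∀ᵐ x ∂μ, 0 < x) : pathLaw α lam r μ =
      (gammaMeasure α lam).withDensity fun u => ENNReal.ofReal (relDensity α lam μ r u) := by
  rw [pathLaw_eq_withDensity hα hlam hr hμ]
  refine withDensity_congr_ae ?_
  filter_upwards [gammaMeasure_ae_pos α lam] with u hu
  rw [relDensity_eq_integral, ofReal_integral_eq_lintegral_ofReal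
    (integrable_transDensity hα hlam hr hμ u)]
  filter_upwards [hμ] with x hx
  exact (transDensity_pos hα hlam hr hx.le hu.le).le

lemma hasDerivAt_exp_neg_mul_space (r u : ℝ) :
    HasDerivAt (fun u => Real.exp (-(r * u))) (Real.exp (-(r * u)) * -(r * 1)) u :=
  ((hasDerivAt_id u).const_mul r).neg.exp

lemma hasDerivAt_relDensity_space (hα : 1 / 2 ≤ α) (hlam : 0 < lam) {r : ℝ} (hr : 0 < r)
    (hμ : ∀ᵐ x ∂μ, 0 < x) (u : ℝ) :
    HasDerivAt (relDensity α lam μ r) (relDensity' α lam μ r u) u := by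
  refine (((hasDerivAt_exp_neg_mul_space r u).mul
    (hasDerivAt_lap_space hlam hα hr hμ 0 u)).const_mul _).congr_deriv ?_
  rw [relDensity']
  ring

lemma hasDerivAt_relDensity'_space (hα : 1 / 2 ≤ α) (hlam : 0 < lam) {r : ℝ} (hr : 0 < r)
    (hμ : ∀ᵐ x ∂μ, 0 < x) (u : ℝ) :
    HasDerivAt (relDensity' α lam μ r) (relDensity'' α lam μ r u) u := by
  refine (((hasDerivAt_exp_neg_mul_space r u).mul
    (((hasDerivAt_lap_space hlam hα hr hμ 0 u).const_mul (-r)).add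
      ((hasDerivAt_lap_space hlam (by linarith : 1 / 2 ≤ α + 1) hr hμ 1 u).const_mul
        (r * (r + lam) / α)))).const_mul _).congr_deriv ?_
  rw [relDensity'']
  simp only [Pi.add_apply]
  ring

/-- The backward equation: in the time `r`, the density evolves by `-1 / (r (r + λ))` times the
Laguerre operator `u ∂ᵤ² + (α - λ u) ∂ᵤ`. -/
lemma hasDerivAt_relDensity_time (hα : 1 / 2 ≤ α) (hlam : 0 < lam) {r : ℝ} (hr : 0 < r)
    (hμ : ∀ᵐ x ∂μ, 0 < x) (u : ℝ) :
    HasDerivAt (fun r => relDensity α lam μ r u)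
      (-(u * relDensity'' α lam μ r u + (α - lam * u) * relDensity' α lam μ r u) /
        (r * (r + lam))) r := by
  have hs : 0 < r + lam := by positivity
  have hα0 : 0 < α := by linarith
  have h1 : HasDerivAt (fun r => ((r + lam) / lam) ^ α)
      (1 / lam * α * ((r + lam) / lam) ^ (α - 1)) r :=
    (((hasDerivAt_id r).add_const lam).div_const lam).rpow_const
      (Or.inl (by simp only [id]; positivity))
  have h2 : HasDerivAt (fun r => Real.exp (-(r * u))) (Real.exp (-(r * u)) * -(1 * u)) r :=
    ((hasDerivAt_id r).mul_const u).neg.exp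
  refine (h1.mul (h2.mul (hasDerivAt_lap_time hlam hα hr hμ 0 u))).congr_deriv ?_
  rw [Real.rpow_sub_one (by positivity), zero_add, lap_eq hlam hα hr hμ 1 u, relDensity',
    relDensity'']
  simp only [Pi.mul_apply]
  generalize ((r + lam) / lam) ^ α = A
  generalize Real.exp (-(r * u)) = E
  generalize lap lam μ α 0 r u = L0
  generalize lap lam μ (α + 1) 1 r u = L1
  norm_num only
  generalize lap lam μ (α + 1 + 1) 2 r u = L2
  field_simp
  ring

end

/-! ### Balance laws on the half-line -/

section

lemma lintegral_Ioc_ofReal {f : ℝ → ℝ} {a b : ℝ} (hab : a ≤ b)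
    (hf : IntegrableOn f (Ioc a b)) (h0 : ∀ x ∈ Ioc a b, 0 ≤ f x) :
    ∫⁻ x in Ioc a b, ENNReal.ofReal (f x) = ENNReal.ofReal (∫ x in a..b, f x) := by
  rw [intervalIntegral.integral_of_le hab, ofReal_integral_eq_lintegral_ofReal hf]
  exact (ae_restrict_mem measurableSet_Ioc).mono h0

lemma tendsto_lintegral_Ioc (f : ℝ → ℝ≥0∞) :
    Tendsto (fun n : ℕ => ∫⁻ x in Ioc (1 / ((n : ℝ) + 1)) (n + 1), f x) atTop
      (𝓝 (∫⁻ x in Ioi (0 : ℝ), f x)) := by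
  have hmono : Monotone fun n : ℕ => Ioc (1 / ((n : ℝ) + 1)) ((n : ℝ) + 1) := by
    intro m n hmn
    have : (m : ℝ) ≤ n := Nat.cast_le.2 hmn
    exact Ioc_subset_Ioc (by gcongr) (by gcongr)
  have hU : ⋃ n : ℕ, Ioc (1 / ((n : ℝ) + 1)) ((n : ℝ) + 1) = Ioi (0 : ℝ) := by
    ext x
    simp only [mem_iUnion, mem_Ioc, mem_Ioi]
    constructor
    · rintro ⟨n, h, -⟩
      exact lt_trans (by positivity) h
    · intro hx
      obtain ⟨n, hn⟩ := exists_nat_one_div_lt hx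
      obtain ⟨m, hm⟩ := exists_nat_ge x
      have h1 : (n : ℝ) ≤ (max n m : ℕ) := Nat.cast_le.2 (le_max_left _ _)
      have h2 : (m : ℝ) ≤ (max n m : ℕ) := Nat.cast_le.2 (le_max_right _ _)
      refine ⟨max n m, lt_of_le_of_lt ?_ hn, ?_⟩
      · gcongr
      · linarith
  have := tendsto_measure_iUnion_atTop (μ := volume.withDensity f) hmono
  simpa only [Function.comp_def, hU, withDensity_apply _ measurableSet_Ioc,
    withDensity_apply _ measurableSet_Ioi] using this

/-- A balance law `∂ᵣ F + ∂ᵤ S = K` integrated over a rectangle. -/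
lemma balance_rectangle {F S T K : ℝ → ℝ → ℝ} {a b δ R : ℝ} (hab : a ≤ b) (hδ : 0 < δ)
    (hδR : δ ≤ R)
    (hF : ∀ r ∈ Icc a b, ∀ u, 0 < u → HasDerivAt (fun r => F r u) (T r u) r)
    (hS : ∀ r ∈ Icc a b, ∀ u, 0 < u → HasDerivAt (S r) (K r u - T r u) u)
    (cF : ∀ r ∈ Icc a b, ContinuousOn (F r) (Ioi 0))
    (cT : ContinuousOn (fun p : ℝ × ℝ => T p.1 p.2) (Icc a b ×ˢ Ioi 0))
    (cK : ContinuousOn (fun p : ℝ × ℝ => K p.1 p.2) (Icc a b ×ˢ Ioi 0)) :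
    (∫ u in δ..R, F b u) - ∫ u in δ..R, F a u =
      (∫ r in a..b, ∫ u in δ..R, K r u) - ∫ r in a..b, (S r R - S r δ) := by
  have hsub : Icc δ R ⊆ Ioi 0 := fun u hu => hδ.trans_le hu.1
  have hsub2 : Icc a b ×ˢ Icc δ R ⊆ Icc a b ×ˢ Ioi 0 := prod_mono subset_rfl hsub
  have iF : ∀ r ∈ Icc a b, IntervalIntegrable (F r) volume δ R := fun r hr =>
    ((cF r hr).mono (by rwa [uIcc_of_le hδR])).intervalIntegrable
  have int2 : ∀ {G : ℝ → ℝ → ℝ}, ContinuousOn (fun p : ℝ × ℝ => G p.1 p.2) (Icc a b ×ˢ Ioi 0) →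
      IntegrableOn (fun p : ℝ × ℝ => G p.1 p.2) (Ioc a b ×ˢ Ioc δ R) := fun cG =>
    ((cG.mono hsub2).integrableOn_compact (isCompact_Icc.prod isCompact_Icc)).mono_set
      (prod_mono Ioc_subset_Icc_self Ioc_subset_Icc_self)
  have icol : ∀ {G : ℝ → ℝ → ℝ}, ContinuousOn (fun p : ℝ × ℝ => G p.1 p.2) (Icc a b ×ˢ Ioi 0) →
      ∀ u, 0 < u → IntervalIntegrable (fun r => G r u) volume a b := fun cG u hu =>
    ContinuousOn.intervalIntegrable (by
      rw [uIcc_of_le hab]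
      exact cG.comp (f := fun r => (r, u)) (by fun_prop) fun r hr => ⟨hr, hu⟩)
  have irow : ∀ {G : ℝ → ℝ → ℝ}, ContinuousOn (fun p : ℝ × ℝ => G p.1 p.2) (Icc a b ×ˢ Ioi 0) →
      ∀ r ∈ Icc a b, IntervalIntegrable (G r) volume δ R := fun cG r hr =>
    ContinuousOn.intervalIntegrable (by
      rw [uIcc_of_le hδR]
      exact cG.comp (f := fun u => (r, u)) (by fun_prop) fun u hu => ⟨hr, hsub hu⟩)
  have iiK : IntervalIntegrable (fun r => ∫ u in δ..R, K r u) volume a b := by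
    rw [intervalIntegrable_iff_integrableOn_Ioc_of_le hab]
    simp_rw [intervalIntegral.integral_of_le hδR]
    have := int2 cK
    rw [IntegrableOn, Measure.volume_eq_prod, ← Measure.prod_restrict] at this
    exact this.integral_prod_left
  have iiT : IntervalIntegrable (fun r => ∫ u in δ..R, T r u) volume a b := by
    rw [intervalIntegrable_iff_integrableOn_Ioc_of_le hab]
    simp_rw [intervalIntegral.integral_of_le hδR]
    have := int2 cT
    rw [IntegrableOn, Measure.volume_eq_prod, ← Measure.prod_restrict] at this
    exact this.integral_prod_left
  have hrow : ∀ r ∈ Icc a b, (∫ u in δ..R, K r u) - (∫ u in δ..R, T r u) = S r R - S r δ := by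
    intro r hr
    rw [← intervalIntegral.integral_sub (irow cK r hr) (irow cT r hr)]
    refine intervalIntegral.integral_eq_sub_of_hasDerivAt (fun u hu => hS r hr u ?_)
      ((irow cK r hr).sub (irow cT r hr))
    rw [uIcc_of_le hδR] at hu
    exact hsub hu
  have hswap : ∫ u in δ..R, (F b u - F a u) = ∫ r in a..b, ∫ u in δ..R, T r u := by
    rw [intervalIntegral_intervalIntegral_swap (F := T)
      (by rw [uIoc_of_le hab, uIoc_of_le hδR]; exact int2 cT)]
    refine intervalIntegral.integral_congr fun u hu => ?_
    rw [uIcc_of_le hδR] at hu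
    refine (intervalIntegral.integral_eq_sub_of_hasDerivAt (f := fun r => F r u)
      (fun r hr => ?_) (icol cT u (hsub hu))).symm
    rw [uIcc_of_le hab] at hr
    exact hF r hr u (hsub hu)
  rw [← intervalIntegral.integral_sub (iF b ⟨hab, le_rfl⟩) (iF a ⟨le_rfl, hab⟩), hswap]
  have : ∫ r in a..b, (S r R - S r δ) =
      ∫ r in a..b, ((∫ u in δ..R, K r u) - (∫ u in δ..R, T r u)) := by
    refine intervalIntegral.integral_congr fun r hr => ?_
    rw [uIcc_of_le hab] at hr
    exact (hrow r hr).symm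
  rw [this, intervalIntegral.integral_sub iiK iiT]
  ring

/-- A balance law `∂ᵣ F + ∂ᵤ S = K` integrated over `[a, b] × (0, ∞)`, for nonnegative `F` and `K`
and a flux `S` that vanishes at `0` and at infinity. No integrability of `F` is needed. -/
lemma balance_halfLine {F S T K : ℝ → ℝ → ℝ} {a b : ℝ} {β : ℝ → ℝ} (hab : a ≤ b)
    (hF : ∀ r ∈ Icc a b, ∀ u, 0 < u → HasDerivAt (fun r => F r u) (T r u) r)
    (hS : ∀ r ∈ Icc a b, ∀ u, 0 < u → HasDerivAt (S r) (K r u - T r u) u)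
    (cF : ∀ r ∈ Icc a b, ContinuousOn (F r) (Ioi 0))
    (cT : ContinuousOn (fun p : ℝ × ℝ => T p.1 p.2) (Icc a b ×ˢ Ioi 0))
    (cK : ContinuousOn (fun p : ℝ × ℝ => K p.1 p.2) (Icc a b ×ˢ Ioi 0))
    (F0 : ∀ r ∈ Icc a b, ∀ u, 0 < u → 0 ≤ F r u)
    (K0 : ∀ r ∈ Icc a b, ∀ u, 0 < u → 0 ≤ K r u)
    (hβ : ∀ r ∈ Icc a b, ∀ u, 0 < u → |S r u| ≤ β u)
    (hβ0 : Tendsto β (𝓝[>] 0) (𝓝 0)) (hβi : Tendsto β atTop (𝓝 0)) :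
    ∫⁻ u in Ioi (0 : ℝ), ENNReal.ofReal (F b u) = (∫⁻ u in Ioi (0 : ℝ), ENNReal.ofReal (F a u)) +
      ∫⁻ r in Ioc a b, ∫⁻ u in Ioi (0 : ℝ), ENNReal.ofReal (K r u) := by
  set δ : ℕ → ℝ := fun n => 1 / ((n : ℝ) + 1) with hδdef
  set R : ℕ → ℝ := fun n => (n : ℝ) + 1 with hRdef
  have hδ : ∀ n, 0 < δ n := fun n => by simp only [hδdef]; positivity
  have hδR : ∀ n, δ n ≤ R n := by
    intro n
    have h0 : (0 : ℝ) ≤ n := n.cast_nonneg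
    refine le_trans (b := 1) ?_ ?_
    · exact (div_le_one (by positivity)).2 (by linarith)
    · simp only [hRdef]; linarith
  have hsub : ∀ n, Icc (δ n) (R n) ⊆ Ioi 0 := fun n u hu => (hδ n).trans_le hu.1
  -- the bound for the total flux through the two sides of `[a, b] × [δ n, R n]`
  set e : ℕ → ℝ := fun n => (β (R n) + β (δ n)) * |b - a| with hedef
  have he : Tendsto (fun n => ENNReal.ofReal (e n)) atTop (𝓝 0) := by
    have h1 : Tendsto R atTop atTop := tendsto_atTop_add_const_right _ _ tendsto_natCast_atTop_atTop
    have h2 : Tendsto δ atTop (𝓝[>] 0) := tendsto_nhdsWithin_iff.2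
      ⟨tendsto_one_div_add_atTop_nhds_zero_nat, Eventually.of_forall hδ⟩
    have h3 := ((hβi.comp h1).add (hβ0.comp h2)).mul_const |b - a|
    simp only [add_zero, zero_mul] at h3
    have := ENNReal.tendsto_ofReal h3
    rwa [ENNReal.ofReal_zero] at this
  -- the three integrals over a rectangle, in `ℝ` and in `ℝ≥0∞`
  have iF : ∀ r ∈ Icc a b, ∀ n, IntegrableOn (F r) (Ioc (δ n) (R n)) := fun r hr n =>
    (((cF r hr).mono (hsub n)).integrableOn_Icc).mono_set Ioc_subset_Icc_self
  have eF : ∀ r ∈ Icc a b, ∀ n, ∫⁻ u in Ioc (δ n) (R n), ENNReal.ofReal (F r u) =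
      ENNReal.ofReal (∫ u in (δ n)..(R n), F r u) := fun r hr n =>
    lintegral_Ioc_ofReal (hδR n) (iF r hr n) fun u hu => F0 r hr u ((hδ n).trans hu.1)
  have pF : ∀ r ∈ Icc a b, ∀ n, 0 ≤ ∫ u in (δ n)..(R n), F r u := fun r hr n =>
    intervalIntegral.integral_nonneg (hδR n) fun u hu => F0 r hr u (hsub n hu)
  have iK : ∀ r ∈ Icc a b, ∀ n, IntegrableOn (K r) (Ioc (δ n) (R n)) := fun r hr n =>
    ((ContinuousOn.integrableOn_Icc (cK.comp (f := fun u => (r, u)) (by fun_prop)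
      fun u hu => ⟨hr, hsub n hu⟩))).mono_set Ioc_subset_Icc_self
  have pK : ∀ r ∈ Icc a b, ∀ n, 0 ≤ ∫ u in (δ n)..(R n), K r u := fun r hr n =>
    intervalIntegral.integral_nonneg (hδR n) fun u hu => K0 r hr u (hsub n hu)
  have eK : ∀ n, ∫⁻ r in Ioc a b, ∫⁻ u in Ioc (δ n) (R n), ENNReal.ofReal (K r u) =
      ENNReal.ofReal (∫ r in a..b, ∫ u in (δ n)..(R n), K r u) := by
    intro n
    have h1 : ∫⁻ r in Ioc a b, ∫⁻ u in Ioc (δ n) (R n), ENNReal.ofReal (K r u) =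
        ∫⁻ r in Ioc a b, ENNReal.ofReal (∫ u in (δ n)..(R n), K r u) := by
      refine setLIntegral_congr_fun measurableSet_Ioc fun r hr => ?_
      have hr' := Ioc_subset_Icc_self hr
      exact lintegral_Ioc_ofReal (hδR n) (iK r hr' n) fun u hu => K0 r hr' u ((hδ n).trans hu.1)
    rw [h1]
    refine lintegral_Ioc_ofReal hab ?_ fun r hr => pK r (Ioc_subset_Icc_self hr) n
    have h2 : IntegrableOn (fun p : ℝ × ℝ => K p.1 p.2) (Ioc a b ×ˢ Ioc (δ n) (R n)) :=
      ((cK.mono (prod_mono subset_rfl (hsub n))).integrableOn_compact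
        (isCompact_Icc.prod isCompact_Icc)).mono_set
        (prod_mono Ioc_subset_Icc_self Ioc_subset_Icc_self)
    rw [IntegrableOn, Measure.volume_eq_prod, ← Measure.prod_restrict] at h2
    simp_rw [intervalIntegral.integral_of_le (hδR n)]
    exact h2.integral_prod_left
  have pKK : ∀ n, 0 ≤ ∫ r in a..b, ∫ u in (δ n)..(R n), K r u := fun n =>
    intervalIntegral.integral_nonneg hab fun r hr => pK r hr n
  have hb : b ∈ Icc a b := ⟨hab, le_rfl⟩
  have ha : a ∈ Icc a b := ⟨le_rfl, hab⟩
  have hbal := fun n => balance_rectangle hab (hδ n) (hδR n) hF hS cF cT cK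
  have hflux : ∀ n, |∫ r in a..b, (S r (R n) - S r (δ n))| ≤ e n := by
    intro n
    rw [← Real.norm_eq_abs]
    refine intervalIntegral.norm_integral_le_of_norm_le_const fun r hr => ?_
    rw [uIoc_of_le hab] at hr
    have hr' := Ioc_subset_Icc_self hr
    exact (abs_sub _ _).trans (add_le_add
      (hβ r hr' _ ((hδ n).trans_le (hδR n))) (hβ r hr' _ (hδ n)))
  have he0 : ∀ n, 0 ≤ e n := fun n => (abs_nonneg _).trans (hflux n)
  -- passage to the limit
  have tF : ∀ r, Tendsto (fun n => ∫⁻ u in Ioc (δ n) (R n), ENNReal.ofReal (F r u)) atTop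
      (𝓝 (∫⁻ u in Ioi (0 : ℝ), ENNReal.ofReal (F r u))) := fun r => tendsto_lintegral_Ioc _
  have tK : Tendsto (fun n => ∫⁻ r in Ioc a b, ∫⁻ u in Ioc (δ n) (R n), ENNReal.ofReal (K r u))
      atTop (𝓝 (∫⁻ r in Ioc a b, ∫⁻ u in Ioi (0 : ℝ), ENNReal.ofReal (K r u))) := by
    refine lintegral_tendsto_of_tendsto_of_monotone (fun n => ?_) ?_ ?_
    · have hm : AEMeasurable (fun p : ℝ × ℝ => ENNReal.ofReal (K p.1 p.2))
          ((volume.restrict (Ioc a b)).prod (volume.restrict (Ioc (δ n) (R n)))) := by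
        rw [Measure.prod_restrict]
        exact ((cK.mono (prod_mono Ioc_subset_Icc_self
          (Ioc_subset_Icc_self.trans (hsub n)))).aemeasurable
          (measurableSet_Ioc.prod measurableSet_Ioc)).ennreal_ofReal
      exact hm.lintegral_prod_right'
    · refine ae_of_all _ fun r m n hmn => lintegral_mono_set ?_
      have : (m : ℝ) ≤ n := Nat.cast_le.2 hmn
      simp only [hδdef, hRdef]
      exact Ioc_subset_Ioc (by gcongr) (by gcongr)
    · exact ae_of_all _ fun r => tendsto_lintegral_Ioc _
  refine le_antisymm ?_ ?_
  · have h1 := ((tF a).add tK).add he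
    rw [add_zero] at h1
    refine le_of_tendsto_of_tendsto' (tF b) h1 fun n => ?_
    rw [eF b hb, eF a ha, eK, ← ENNReal.ofReal_add (pF a ha n) (pKK n),
      ← ENNReal.ofReal_add (add_nonneg (pF a ha n) (pKK n)) (he0 n)]
    refine ENNReal.ofReal_le_ofReal ?_
    have := hbal n
    have := neg_le_of_abs_le (hflux n)
    linarith
  · have h1 := (tF b).add he
    rw [add_zero] at h1
    refine le_of_tendsto_of_tendsto' ((tF a).add tK) h1 fun n => ?_
    rw [eF b hb, eF a ha, eK, ← ENNReal.ofReal_add (pF a ha n) (pKK n),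
      ← ENNReal.ofReal_add (pF b hb n) (he0 n)]
    refine ENNReal.ofReal_le_ofReal ?_
    have := hbal n
    have := le_of_abs_le (hflux n)
    linarith

end

/-! ### Bounds on the density of the path -/

section

variable {μ : Measure ℝ} [IsProbabilityMeasure μ] {α lam : ℝ}

lemma integrable_exp_neg_mul (hμ : ∀ᵐ x ∂μ, 0 < x) {r : ℝ} (hr : 0 < r) :
    Integrable (fun x => Real.exp (-(r * x))) μ := by
  refine Integrable.of_bound (by fun_prop) 1 ?_
  filter_upwards [hμ] with x hx
  rw [Real.norm_eq_abs, Real.abs_exp, Real.exp_le_one_iff]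
  have : 0 < r * x := by positivity
  linarith

/-- The growth bound of `bes`, with the square completed: the exponent is
`(r + λ) u - (√(r x) - √((r + λ) u))²`. -/
lemma lap_le_exp {β r u : ℝ} (hlam : 0 < lam) (hβ : 1 / 2 ≤ β) (hr : 0 < r)
    (hμ : ∀ᵐ x ∂μ, 0 < x) (hu : 0 ≤ u) : lap lam μ β 0 r u ≤ Real.exp ((r + lam) * u) := by
  have h : ∀ᵐ x ∂μ, lapKernel lam β 0 r u x ≤ Real.exp ((r + lam) * u) := by
    filter_upwards [hμ] with x hx
    refine (le_abs_self _).trans ((abs_lapKernel_le hlam hβ hr hx.le 0 u).trans ?_)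
    rw [pow_zero, one_mul, abs_of_nonneg hu, Real.exp_le_exp]
    have ha : 0 ≤ r * x := by positivity
    have hb : 0 ≤ (r + lam) * u := by positivity
    rw [Real.sqrt_mul ha]
    nlinarith [Real.sq_sqrt ha, Real.sq_sqrt hb,
      sq_nonneg (Real.sqrt (r * x) - Real.sqrt ((r + lam) * u))]
  have := integral_mono_ae (integrable_lapKernel hlam hβ hr hμ 0 u)
    (integrable_const (Real.exp ((r + lam) * u))) h
  simpa [lap] using this

lemma relDensity_le (hα : 1 / 2 ≤ α) (hlam : 0 < lam) {r : ℝ} (hr : 0 < r)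
    (hμ : ∀ᵐ x ∂μ, 0 < x) {u : ℝ} (hu : 0 ≤ u) :
    relDensity α lam μ r u ≤ ((r + lam) / lam) ^ α * Real.exp (lam * u) := by
  rw [relDensity, show lam * u = -(r * u) + (r + lam) * u by ring, Real.exp_add]
  have := lap_le_exp hlam hα hr hμ hu
  gcongr

lemma one_le_rpow_div (hα : 1 / 2 ≤ α) (hlam : 0 < lam) {r : ℝ} (hr : 0 ≤ r) :
    1 ≤ ((r + lam) / lam) ^ α :=
  Real.one_le_rpow ((one_le_div hlam).2 (by linarith)) (by linarith)

/-- A lower bound for the density, from `bes ≥ 1`. -/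
lemma le_relDensity (hα : 1 / 2 ≤ α) (hlam : 0 < lam) {r b : ℝ} (hr : 0 < r) (hb : r ≤ b)
    (hμ : ∀ᵐ x ∂μ, 0 < x) {u : ℝ} (hu : 0 ≤ u) :
    Real.exp (-(b * u)) * ∫ x, Real.exp (-(b * x)) ∂μ ≤ relDensity α lam μ r u := by
  have h1 := one_le_rpow_div hα hlam hr.le
  have h2 : ∫ x, Real.exp (-(b * x)) ∂μ ≤ lap lam μ α 0 r u := by
    refine integral_mono_ae (integrable_exp_neg_mul hμ (hr.trans_le hb))
      (integrable_lapKernel hlam hα hr hμ 0 u) ?_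
    filter_upwards [hμ] with x hx
    have h3 := one_le_bes hα (by positivity : 0 ≤ r * (r + lam) * x * u)
    have h4 : Real.exp (-(b * x)) ≤ Real.exp (-(r * x)) := by gcongr
    calc Real.exp (-(b * x)) ≤ Real.exp (-(r * x)) * 1 := by rwa [mul_one]
      _ ≤ Real.exp (-(r * x)) * bes α (r * (r + lam) * x * u) := by gcongr
      _ = lapKernel lam α 0 r u x := by rw [lapKernel, pow_zero, one_mul]
  have h0 : 0 ≤ ∫ x, Real.exp (-(b * x)) ∂μ := integral_nonneg fun x => (Real.exp_pos _).le
  calc Real.exp (-(b * u)) * ∫ x, Real.exp (-(b * x)) ∂μ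
      ≤ 1 * (Real.exp (-(r * u)) * lap lam μ α 0 r u) := by rw [one_mul]; gcongr
    _ ≤ relDensity α lam μ r u := by
        rw [relDensity]
        have := h0.trans h2
        gcongr

lemma integral_exp_neg_mul_pos (hμ : ∀ᵐ x ∂μ, 0 < x) {b : ℝ} (hb : 0 < b) :
    0 < ∫ x, Real.exp (-(b * x)) ∂μ :=
  integral_exp_pos (integrable_exp_neg_mul hμ hb)

lemma relDensity_pos (hα : 1 / 2 ≤ α) (hlam : 0 < lam) {r : ℝ} (hr : 0 < r)
    (hμ : ∀ᵐ x ∂μ, 0 < x) {u : ℝ} (hu : 0 ≤ u) : 0 < relDensity α lam μ r u :=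
  (mul_pos (Real.exp_pos _) (integral_exp_neg_mul_pos hμ hr)).trans_le
    (le_relDensity hα hlam hr le_rfl hμ hu)

/-- The logarithm of the density grows at most linearly, uniformly for `r ∈ (0, b]`. -/
lemma exists_abs_log_relDensity_le (hα : 1 / 2 ≤ α) (hlam : 0 < lam) {b : ℝ} (hb : 0 < b)
    (hμ : ∀ᵐ x ∂μ, 0 < x) : ∃ L : ℝ, 0 ≤ L ∧ ∀ r, 0 < r → r ≤ b → ∀ u, 0 ≤ u →
      |Real.log (relDensity α lam μ r u)| ≤ L * (1 + u) := by
  set m := ∫ x, Real.exp (-(b * x)) ∂μ with hm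
  have hm0 : 0 < m := integral_exp_neg_mul_pos hμ hb
  set A := ((b + lam) / lam) ^ α with hA
  have hA1 : 1 ≤ A := one_le_rpow_div hα hlam hb.le
  refine ⟨Real.log A + lam + b + |Real.log m|, ?_, fun r hr hrb u hu => ?_⟩
  · have := Real.log_nonneg hA1
    positivity
  · have hlA := Real.log_nonneg hA1
    have hh := relDensity_pos hα hlam hr hμ hu
    have hup : Real.log (relDensity α lam μ r u) ≤ Real.log A + lam * u := by
      rw [← Real.log_exp (lam * u), ← Real.log_mul (by positivity) (Real.exp_ne_zero _)]
      refine Real.log_le_log hh ((relDensity_le hα hlam hr hμ hu).trans ?_)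
      have : 0 ≤ α := by linarith
      rw [hA]
      gcongr
    have hlow : -(b * u) + Real.log m ≤ Real.log (relDensity α lam μ r u) := by
      rw [← Real.log_exp (-(b * u)), ← Real.log_mul (Real.exp_ne_zero _) hm0.ne']
      exact Real.log_le_log (by positivity) (le_relDensity hα hlam hr hrb hμ hu)
    have h1 := neg_abs_le (Real.log m)
    have h2 := abs_nonneg (Real.log m)
    have h3 : 0 ≤ (Real.log A + |Real.log m|) * u := by positivity
    have h4 : 0 ≤ b * u := by positivity
    have h5 : 0 ≤ lam * u := by positivity
    rw [abs_le]
    constructor <;> nlinarith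

lemma rpow_le_mul_exp {p y : ℝ} (hp : 0 < p) (hy : 0 ≤ y) : y ^ p ≤ p ^ p * Real.exp y := by
  have h1 : y / p ≤ Real.exp (y / p) := by linarith [Real.add_one_le_exp (y / p)]
  have h2 : (y / p) ^ p ≤ Real.exp (y / p) ^ p := Real.rpow_le_rpow (by positivity) h1 hp.le
  rw [← Real.exp_mul, div_mul_cancel₀ _ hp.ne', Real.div_rpow hy hp.le,
    div_le_iff₀ (by positivity)] at h2
  linarith

/-- The transition density decays like a power `p` of `x / u` for `u` large, uniformly in time. The
exponent is `-(√(r x) - √((r + λ) u))²`: either `u ≤ 4 x`, or it is at most `-λ u / 4`. -/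
lemma exp_decay {p r x u : ℝ} (hp : 0 < p) (hlam : 0 < lam) (hr : 0 < r) (hx : 0 < x)
    (hu : 0 < u) :
    Real.exp (-((r + lam) * u)) * Real.exp (-(r * x) + 2 * Real.sqrt ((r * x) * ((r + lam) * u))) ≤
      (4 ^ p + (4 * p / lam) ^ p) * (1 + x) ^ p * u ^ (-p) := by
  have ha : 0 ≤ r * x := by positivity
  have hb : 0 ≤ (r + lam) * u := by positivity
  rw [← Real.exp_add, Real.sqrt_mul ha, Real.rpow_neg hu.le, ← div_eq_mul_inv,
    le_div_iff₀ (by positivity)]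
  rcases le_or_gt u (4 * x) with h | h
  · have h1 : Real.exp (-((r + lam) * u) +
        (-(r * x) + 2 * (Real.sqrt (r * x) * Real.sqrt ((r + lam) * u)))) ≤ 1 := by
      rw [Real.exp_le_one_iff]
      nlinarith [Real.sq_sqrt ha, Real.sq_sqrt hb,
        sq_nonneg (Real.sqrt (r * x) - Real.sqrt ((r + lam) * u))]
    have h2 : u ^ p ≤ 4 ^ p * (1 + x) ^ p := by
      rw [← Real.mul_rpow (by norm_num) (by positivity)]
      exact Real.rpow_le_rpow hu.le (by linarith) hp.le
    have h3 : 0 ≤ (4 * p / lam) ^ p * (1 + x) ^ p := by positivity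
    calc _ ≤ 1 * (4 ^ p * (1 + x) ^ p) := by gcongr
      _ ≤ _ := by linarith
  · have hab : Real.sqrt (r * x) ≤ Real.sqrt ((r + lam) * u) / 2 := by
      rw [show Real.sqrt ((r + lam) * u) / 2 = Real.sqrt ((r + lam) * u / 4) by
        rw [Real.sqrt_div hb, show (4 : ℝ) = 2 ^ 2 by norm_num, Real.sqrt_sq (by norm_num)]]
      refine Real.sqrt_le_sqrt ?_
      nlinarith
    have h1 : Real.exp (-((r + lam) * u) +
        (-(r * x) + 2 * (Real.sqrt (r * x) * Real.sqrt ((r + lam) * u)))) ≤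
          Real.exp (-(lam * u / 4)) := by
      rw [Real.exp_le_exp]
      have h0 := Real.sqrt_nonneg ((r + lam) * u)
      have hru : 0 ≤ r * u := by positivity
      nlinarith [Real.sq_sqrt ha, Real.sq_sqrt hb]
    have h2 : u ^ p ≤ (4 * p / lam) ^ p * Real.exp (lam * u / 4) := by
      have := rpow_le_mul_exp hp (by positivity : 0 ≤ lam * u / 4)
      calc u ^ p = (4 / lam) ^ p * (lam * u / 4) ^ p := by
            rw [← Real.mul_rpow (by positivity) (by positivity)]; congr 1; field_simp
        _ ≤ (4 / lam) ^ p * (p ^ p * Real.exp (lam * u / 4)) := by gcongr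
        _ = _ := by
            rw [← mul_assoc, ← Real.mul_rpow (by positivity) hp.le]; congr 2; ring
    have h3 : 1 ≤ (1 + x) ^ p := Real.one_le_rpow (by linarith) hp.le
    have h4 : (0 : ℝ) ≤ 4 ^ p * (1 + x) ^ p := by positivity
    calc _ ≤ Real.exp (-(lam * u / 4)) * ((4 * p / lam) ^ p * Real.exp (lam * u / 4)) := by gcongr
      _ = (4 * p / lam) ^ p * 1 := by
          rw [mul_left_comm, ← Real.exp_add, neg_add_cancel, Real.exp_zero]
      _ ≤ (4 * p / lam) ^ p * (1 + x) ^ p := by gcongr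
      _ ≤ _ := by linarith

lemma integrable_one_add_rpow (hμ : ∀ᵐ x ∂μ, 0 < x) {q : ℝ} (hq : 1 ≤ q)
    (hint : Integrable (fun x => x ^ q) μ) : Integrable (fun x => (1 + x) ^ q) μ := by
  refine Integrable.mono' (((integrable_const (1 : ℝ)).add hint).const_mul (2 ^ (q - 1)))
    (Measurable.aestronglyMeasurable (by fun_prop)) ?_
  filter_upwards [hμ] with x hx
  rw [Real.norm_of_nonneg (by positivity)]
  have := NNReal.coe_le_coe.2 (NNReal.rpow_add_le_mul_rpow_add_rpow 1 x.toNNReal hq)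
  simpa [hx.le] using this

/-- Polynomial decay of the mixed moments, uniformly in time. -/
lemma exists_lap_decay (hα : 1 / 2 ≤ α) (hlam : 0 < lam) (hμ : ∀ᵐ x ∂μ, 0 < x)
    (hint : Integrable (fun x => x ^ (α + 4)) μ) : ∃ C : ℝ, 0 ≤ C ∧
      ∀ j ≤ 1, ∀ r, 0 < r → ∀ u, 0 < u →
        Real.exp (-((r + lam) * u)) * lap lam μ α j r u ≤ C * u ^ (-(α + 3)) := by
  have hp : 0 < α + 3 := by linarith
  set D : ℝ := 4 ^ (α + 3) + (4 * (α + 3) / lam) ^ (α + 3) with hD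
  have hD0 : 0 ≤ D := by positivity
  have hI := integrable_one_add_rpow hμ (by linarith) hint
  refine ⟨D * ∫ x, (1 + x) ^ (α + 4) ∂μ, ?_, fun j hj r hr u hu => ?_⟩
  · refine mul_nonneg hD0 (integral_nonneg_of_ae ?_)
    filter_upwards [hμ] with x hx
    change 0 ≤ (1 + x) ^ (α + 4)
    positivity
  · have h : ∀ᵐ x ∂μ, Real.exp (-((r + lam) * u)) * lapKernel lam α j r u x ≤
        D * u ^ (-(α + 3)) * (1 + x) ^ (α + 4) := by
      filter_upwards [hμ] with x hx
      have h1 := (le_abs_self _).trans (abs_lapKernel_le hlam hα hr hx.le j u)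
      rw [abs_of_pos hu] at h1
      have h2 := exp_decay hp hlam hr hx hu
      rw [← hD] at h2
      have h3 : x ^ j ≤ 1 + x := by
        interval_cases j
        · simp [hx.le]
        · simp
      calc _ ≤ Real.exp (-((r + lam) * u)) * (x ^ j *
              Real.exp (-(r * x) + 2 * Real.sqrt ((r * x) * ((r + lam) * u)))) := by gcongr
        _ = x ^ j * (Real.exp (-((r + lam) * u)) *
              Real.exp (-(r * x) + 2 * Real.sqrt ((r * x) * ((r + lam) * u)))) := by ring
        _ ≤ (1 + x) * (D * (1 + x) ^ (α + 3) * u ^ (-(α + 3))) := by gcongr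
        _ = _ := by
            rw [show α + 4 = (α + 3) + 1 by ring, Real.rpow_add_one (by positivity)]
            ring
    have := integral_mono_ae ((integrable_lapKernel hlam hα hr hμ j u).const_mul _)
      (hI.const_mul _) h
    rw [integral_const_mul, integral_const_mul] at this
    rw [lap]
    linarith

/-- The space derivative of the density is controlled by two mixed moments. -/
lemma abs_relDensity'_le (hα : 1 / 2 ≤ α) (hlam : 0 < lam) {r : ℝ} (hr : 0 < r)
    (hμ : ∀ᵐ x ∂μ, 0 < x) {u : ℝ} (hu : 0 ≤ u) :
    |relDensity' α lam μ r u| ≤ ((r + lam) / lam) ^ α * (Real.exp (-(r * u)) *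
      (r * lap lam μ α 0 r u + r * (r + lam) / α * lap lam μ α 1 r u)) := by
  have hα0 : 0 < α := by linarith
  have h0 := lap_nonneg hlam hα hr hμ 0 hu
  have h1 := lap_nonneg hlam (by linarith : 1 / 2 ≤ α + 1) hr hμ 1 hu
  have h2 := lap_add_one_le hlam hα hr hμ 1 hu
  rw [relDensity', abs_mul, abs_mul, Real.abs_exp, abs_of_nonneg (by positivity :
    0 ≤ ((r + lam) / lam) ^ α)]
  refine mul_le_mul_of_nonneg_left (mul_le_mul_of_nonneg_left ?_ (Real.exp_pos _).le)
    (by positivity)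
  refine (abs_add_le _ _).trans ?_
  rw [neg_mul, abs_neg, abs_of_nonneg (by positivity), abs_of_nonneg (by positivity)]
  gcongr

end

/-! ### Entropy balance along the path -/

section

variable {μ : Measure ℝ} [IsProbabilityMeasure μ] {α lam : ℝ}

/-- The relative entropy of the path at time `r` with respect to the gamma law, as an integral
over the half-line. -/
def pathEntropy (α lam : ℝ) (μ : Measure ℝ) (r : ℝ) : ℝ≥0∞ :=
  ∫⁻ u in Ioi (0 : ℝ), ENNReal.ofReal (klFun (relDensity α lam μ r u) * gammaPDFReal α lam u)

/-- The density of the entropy production in the time `r`. -/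
def production (α lam : ℝ) (μ : Measure ℝ) (r u : ℝ) : ℝ :=
  u * gammaPDFReal α lam u * relDensity' α lam μ r u ^ 2 / relDensity α lam μ r u / (r * (r + lam))

/-- The flux of entropy through the point `u`. -/
def flux (α lam : ℝ) (μ : Measure ℝ) (r u : ℝ) : ℝ :=
  Real.log (relDensity α lam μ r u) * (u * gammaPDFReal α lam u * relDensity' α lam μ r u) /
    (r * (r + lam))

/-- The time derivative of the entropy density. -/
def entropyRate (α lam : ℝ) (μ : Measure ℝ) (r u : ℝ) : ℝ :=
  Real.log (relDensity α lam μ r u) * (-(u * relDensity'' α lam μ r u +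
    (α - lam * u) * relDensity' α lam μ r u) / (r * (r + lam))) * gammaPDFReal α lam u

lemma gammaPDFReal_of_pos {a s u : ℝ} (hu : 0 < u) :
    gammaPDFReal a s u = s ^ a / Real.Gamma a * u ^ (a - 1) * Real.exp (-(s * u)) :=
  if_pos hu.le

lemma hasDerivAt_gammaPDFReal (a s : ℝ) {u : ℝ} (hu : 0 < u) :
    HasDerivAt (gammaPDFReal a s) (gammaScore a s u * gammaPDFReal a s u) u := by
  have h1 := ((Real.hasDerivAt_rpow_const (x := u) (p := a - 1) (Or.inl hu.ne')).const_mul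
    (s ^ a / Real.Gamma a)).mul (hasDerivAt_exp_neg_mul_space s u)
  have h2 : gammaPDFReal a s =ᶠ[𝓝 u] fun u => s ^ a / Real.Gamma a * u ^ (a - 1) *
      Real.exp (-(s * u)) := by
    filter_upwards [isOpen_Ioi.mem_nhds hu] with v hv
    exact gammaPDFReal_of_pos hv
  refine (h1.congr_of_eventuallyEq h2).congr_deriv ?_
  rw [gammaPDFReal_of_pos hu, gammaScore, Real.rpow_sub_one hu.ne']
  field_simp
  ring

lemma continuousOn_gammaPDFReal (a s : ℝ) : ContinuousOn (gammaPDFReal a s) (Ioi 0) :=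
  fun _ hu => (hasDerivAt_gammaPDFReal a s hu).continuousAt.continuousWithinAt

lemma hasDerivAt_id_mul_gammaPDFReal (a s : ℝ) {u : ℝ} (hu : 0 < u) :
    HasDerivAt (fun u => u * gammaPDFReal a s u) ((a - s * u) * gammaPDFReal a s u) u := by
  refine ((hasDerivAt_id u).mul (hasDerivAt_gammaPDFReal a s hu)).congr_deriv ?_
  simp only [gammaScore, id]
  field_simp
  ring

/-- The entropy density relative to Lebesgue measure is `klFun h` times the gamma density, and
`klFun' = log`. -/
lemma hasDerivAt_entropyDensity_time (hα : 1 / 2 ≤ α) (hlam : 0 < lam) {r : ℝ} (hr : 0 < r)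
    (hμ : ∀ᵐ x ∂μ, 0 < x) {u : ℝ} (hu : 0 < u) :
    HasDerivAt (fun r => klFun (relDensity α lam μ r u) * gammaPDFReal α lam u)
      (entropyRate α lam μ r u) r :=
  ((hasDerivAt_klFun (relDensity_pos hα hlam hr hμ hu.le).ne').comp r
    (hasDerivAt_relDensity_time hα hlam hr hμ u)).mul_const _

/-- The balance law `∂ᵤ flux = production - entropyRate`: the Laguerre operator is in
divergence form for the gamma density. -/
lemma hasDerivAt_flux (hα : 1 / 2 ≤ α) (hlam : 0 < lam) {r : ℝ} (hr : 0 < r)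
    (hμ : ∀ᵐ x ∂μ, 0 < x) {u : ℝ} (hu : 0 < u) :
    HasDerivAt (flux α lam μ r) (production α lam μ r u - entropyRate α lam μ r u) u := by
  have hs : 0 < r + lam := by positivity
  have hh := (relDensity_pos hα hlam hr hμ hu.le).ne'
  have h1 := (hasDerivAt_relDensity_space hα hlam hr hμ u).log hh
  have h2 := (hasDerivAt_id_mul_gammaPDFReal α lam hu).mul
    (hasDerivAt_relDensity'_space hα hlam hr hμ u)
  refine ((h1.mul h2).div_const (r * (r + lam))).congr_deriv ?_
  simp only [production, entropyRate, Pi.mul_apply]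
  field_simp
  ring

lemma continuousOn_time_factors (hlam : 0 < lam) :
    ContinuousOn (fun p : ℝ × ℝ => ((p.1 + lam) / lam) ^ α) {p | 0 < p.1} :=
  ContinuousOn.rpow_const (by fun_prop) fun p (hp : 0 < p.1) => Or.inl (by positivity)

lemma continuousOn_relDensity (hα : 1 / 2 ≤ α) (hlam : 0 < lam) (hμ : ∀ᵐ x ∂μ, 0 < x) :
    ContinuousOn (fun p : ℝ × ℝ => relDensity α lam μ p.1 p.2) {p | 0 < p.1} := by
  have := continuousOn_lap hlam hα hμ 0
  exact (continuousOn_time_factors hlam).mul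
    ((by fun_prop : Continuous fun p : ℝ × ℝ => Real.exp (-(p.1 * p.2))).continuousOn.mul this)

lemma continuousOn_relDensity' (hα : 1 / 2 ≤ α) (hlam : 0 < lam) (hμ : ∀ᵐ x ∂μ, 0 < x) :
    ContinuousOn (fun p : ℝ × ℝ => relDensity' α lam μ p.1 p.2) {p | 0 < p.1} := by
  have h0 := continuousOn_lap hlam hα hμ 0
  have h1 := continuousOn_lap hlam (by linarith : 1 / 2 ≤ α + 1) hμ 1
  exact (continuousOn_time_factors hlam).mul
    ((by fun_prop : Continuous fun p : ℝ × ℝ => Real.exp (-(p.1 * p.2))).continuousOn.mul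
      (by fun_prop))

lemma continuousOn_relDensity'' (hα : 1 / 2 ≤ α) (hlam : 0 < lam) (hμ : ∀ᵐ x ∂μ, 0 < x) :
    ContinuousOn (fun p : ℝ × ℝ => relDensity'' α lam μ p.1 p.2) {p | 0 < p.1} := by
  have h0 := continuousOn_lap hlam hα hμ 0
  have h1 := continuousOn_lap hlam (by linarith : 1 / 2 ≤ α + 1) hμ 1
  have h2 := continuousOn_lap hlam (by linarith : 1 / 2 ≤ α + 1 + 1) hμ 2
  exact (continuousOn_time_factors hlam).mul
    ((by fun_prop : Continuous fun p : ℝ × ℝ => Real.exp (-(p.1 * p.2))).continuousOn.mul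
      (by fun_prop))

lemma continuousOn_gammaPDFReal_snd (α lam : ℝ) :
    ContinuousOn (fun p : ℝ × ℝ => gammaPDFReal α lam p.2) (Ioi 0 ×ˢ Ioi 0) :=
  (continuousOn_gammaPDFReal α lam).comp continuousOn_snd fun _ hp => hp.2

lemma continuousOn_production (hα : 1 / 2 ≤ α) (hlam : 0 < lam) (hμ : ∀ᵐ x ∂μ, 0 < x) :
    ContinuousOn (fun p : ℝ × ℝ => production α lam μ p.1 p.2) (Ioi 0 ×ˢ Ioi 0) := by
  have hsub : Ioi (0 : ℝ) ×ˢ Ioi (0 : ℝ) ⊆ {p : ℝ × ℝ | 0 < p.1} := fun p hp => hp.1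
  have h0 := (continuousOn_relDensity hα hlam hμ).mono hsub
  have h1 := (continuousOn_relDensity' hα hlam hμ).mono hsub
  refine (((continuousOn_snd.mul (continuousOn_gammaPDFReal_snd α lam)).mul (h1.pow 2)).div h0
    fun p hp => ?_).div (by fun_prop) fun p hp => ?_
  · exact (relDensity_pos hα hlam hp.1 hμ (le_of_lt hp.2)).ne'
  · have : 0 < p.1 := hp.1
    positivity

lemma continuousOn_entropyRate (hα : 1 / 2 ≤ α) (hlam : 0 < lam) (hμ : ∀ᵐ x ∂μ, 0 < x) :
    ContinuousOn (fun p : ℝ × ℝ => entropyRate α lam μ p.1 p.2) (Ioi 0 ×ˢ Ioi 0) := by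
  have hsub : Ioi (0 : ℝ) ×ˢ Ioi (0 : ℝ) ⊆ {p : ℝ × ℝ | 0 < p.1} := fun p hp => hp.1
  have h0 := (continuousOn_relDensity hα hlam hμ).mono hsub
  have h1 := (continuousOn_relDensity' hα hlam hμ).mono hsub
  have h2 := (continuousOn_relDensity'' hα hlam hμ).mono hsub
  refine ((h0.log fun p hp => ?_).mul (ContinuousOn.div (by fun_prop) (by fun_prop)
    fun p hp => ?_)).mul (continuousOn_gammaPDFReal_snd α lam)
  · exact (relDensity_pos hα hlam hp.1 hμ (le_of_lt hp.2)).ne'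
  · have : 0 < p.1 := hp.1
    positivity

lemma lap_le_of_le {β r r₁ r₂ u U : ℝ} (hlam : 0 < lam) (hβ : 1 / 2 ≤ β) (h₁ : 0 < r₁)
    (hr₁ : r₁ ≤ r) (hr₂ : r ≤ r₂) (hu : |u| ≤ U) (hμ : ∀ᵐ x ∂μ, 0 < x) (j : ℕ) :
    lap lam μ β j r u ≤ j.factorial * (2 / r₁) ^ j * Real.exp (2 * ((r₂ + lam) * U)) := by
  have h : ∀ᵐ x ∂μ, lapKernel lam β j r u x ≤
      j.factorial * (2 / r₁) ^ j * Real.exp (2 * ((r₂ + lam) * U)) := by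
    filter_upwards [hμ] with x hx
    exact (le_abs_self _).trans (abs_lapKernel_le_of_le hlam hβ h₁ hr₁ hr₂ hu hx.le j)
  have := integral_mono_ae (integrable_lapKernel hlam hβ (h₁.trans_le hr₁) hμ j u)
    (integrable_const _) h
  simpa [lap] using this

/-- The flux vanishes at the origin like `u ^ α` and at infinity like `u ^ (-2)`, uniformly for
times in a compact interval. -/
lemma exists_abs_flux_le (hα : 1 / 2 ≤ α) (hlam : 0 < lam) (hμ : ∀ᵐ x ∂μ, 0 < x)
    (hint : Integrable (fun x => x ^ (α + 4)) μ) {a b : ℝ} (ha : 0 < a) (hab : a ≤ b) :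
    ∃ C : ℝ, 0 ≤ C ∧ ∀ r ∈ Icc a b, ∀ u, 0 < u →
      |flux α lam μ r u| ≤ C * (if u ≤ 1 then u ^ α else u ^ (-2 : ℝ)) := by
  have hα0 : 0 < α := by linarith
  have hb : 0 < b := ha.trans_le hab
  obtain ⟨L, hL0, hL⟩ := exists_abs_log_relDensity_le hα hlam hb hμ
  obtain ⟨D, hD0, hD⟩ := exists_lap_decay hα hlam hμ hint
  set A := ((b + lam) / lam) ^ α with hA
  have hA0 : 0 ≤ A := by positivity
  set c := lam ^ α / Real.Gamma α with hc
  have hc0 : 0 < c := by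
    have := Real.Gamma_pos_of_pos hα0
    positivity
  set E := Real.exp (2 * (b + lam)) with hE
  set C₁ := 2 * L * c * (A * (b * E + b * (b + lam) / α * (2 / a * E))) / (a * (a + lam)) with hC₁
  set C₂ := 2 * L * c * A * D * (b + b * (b + lam) / α) / (a * (a + lam)) with hC₂
  have hC₁0 : 0 ≤ C₁ := by positivity
  have hC₂0 : 0 ≤ C₂ := by positivity
  refine ⟨C₁ + C₂, by positivity, fun r hr u hu => ?_⟩
  have hr0 : 0 < r := ha.trans_le hr.1
  have hra := hr.1
  have hrb := hr.2
  have hAr : ((r + lam) / lam) ^ α ≤ A := by rw [hA]; gcongr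
  have hlog := hL r hr0 hrb u hu.le
  have hd := abs_relDensity'_le hα hlam hr0 hμ hu.le
  have l0 := lap_nonneg hlam hα hr0 hμ 0 hu.le
  have l1 := lap_nonneg hlam hα hr0 hμ 1 hu.le
  have hg := gammaPDFReal_nonneg hα0 hlam u
  have habs : |flux α lam μ r u| = |Real.log (relDensity α lam μ r u)| *
      (u * gammaPDFReal α lam u * |relDensity' α lam μ r u|) / (r * (r + lam)) := by
    rw [flux, abs_div, abs_mul, abs_mul, abs_mul, abs_of_pos hu, abs_of_nonneg hg,
      abs_of_pos (by positivity : 0 < r * (r + lam))]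
  have hug : u * gammaPDFReal α lam u = c * u ^ α * Real.exp (-(lam * u)) := by
    rw [gammaPDFReal_of_pos hu, Real.rpow_sub_one hu.ne', ← hc]
    field_simp
  rw [habs, hug]
  split_ifs with h1
  -- near the origin all mixed moments are bounded and `u * gammaPDF u` is of order `u ^ α`
  · have hu1 : |u| ≤ 1 := by rwa [abs_of_pos hu]
    have e0 : lap lam μ α 0 r u ≤ E := by
      simpa using lap_le_of_le hlam hα ha hra hrb hu1 hμ 0
    have e1 : lap lam μ α 1 r u ≤ 2 / a * E := by
      simpa using lap_le_of_le hlam hα ha hra hrb hu1 hμ 1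
    have x1 : Real.exp (-(lam * u)) ≤ 1 := Real.exp_le_one_iff.2 (by
      have : 0 ≤ lam * u := by positivity
      linarith)
    have x2 : Real.exp (-(r * u)) ≤ 1 := Real.exp_le_one_iff.2 (by
      have : 0 ≤ r * u := by positivity
      linarith)
    calc _ ≤ (L * (1 + 1)) * (c * u ^ α * 1 * (A * (1 * (b * E +
              b * (b + lam) / α * (2 / a * E))))) / (a * (a + lam)) := by
          have hlog' : |Real.log (relDensity α lam μ r u)| ≤ L * (1 + 1) :=
            hlog.trans (by gcongr)
          have hd' : |relDensity' α lam μ r u| ≤ A * (1 * (b * E +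
              b * (b + lam) / α * (2 / a * E))) := hd.trans (by gcongr)
          gcongr
      _ = C₁ * u ^ α := by rw [hC₁]; ring
      _ ≤ (C₁ + C₂) * u ^ α := by gcongr; linarith
  -- at infinity the powers are `1` from the logarithm, `α` from `u * gammaPDF u` and `-(α + 3)`
  -- from the mixed moments
  · have h1 : 1 < u := not_le.1 h1
    have d0 := hD 0 zero_le_one r hr0 u hu
    have d1 := hD 1 le_rfl r hr0 u hu
    have hsplit : Real.exp (-((r + lam) * u)) = Real.exp (-(lam * u)) * Real.exp (-(r * u)) := by
      rw [← Real.exp_add]; congr 1; ring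
    rw [hsplit] at d0 d1
    have hpow : u ^ α * u ^ (-(α + 3)) * u = u ^ (-2 : ℝ) := by
      rw [← Real.rpow_add hu, ← Real.rpow_add_one hu.ne']; congr 1; ring
    calc _ ≤ (L * (u + u)) * (c * u ^ α * Real.exp (-(lam * u)) * (A * (Real.exp (-(r * u)) *
              (b * lap lam μ α 0 r u + b * (b + lam) / α * lap lam μ α 1 r u)))) /
                (a * (a + lam)) := by
          have hlog' : |Real.log (relDensity α lam μ r u)| ≤ L * (u + u) :=
            hlog.trans (by gcongr)
          have hd' : |relDensity' α lam μ r u| ≤ A * (Real.exp (-(r * u)) *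
              (b * lap lam μ α 0 r u + b * (b + lam) / α * lap lam μ α 1 r u)) :=
            hd.trans (by gcongr)
          gcongr
      _ = (L * (u + u)) * (c * u ^ α * (A * (b * (Real.exp (-(lam * u)) * Real.exp (-(r * u)) *
              lap lam μ α 0 r u) + b * (b + lam) / α * (Real.exp (-(lam * u)) *
                Real.exp (-(r * u)) * lap lam μ α 1 r u)))) / (a * (a + lam)) := by ring
      _ ≤ (L * (u + u)) * (c * u ^ α * (A * (b * (D * u ^ (-(α + 3))) +
              b * (b + lam) / α * (D * u ^ (-(α + 3)))))) / (a * (a + lam)) := by gcongr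
      _ = C₂ * (u ^ α * u ^ (-(α + 3)) * u) := by rw [hC₂]; ring
      _ ≤ (C₁ + C₂) * u ^ (-2 : ℝ) := by rw [hpow]; gcongr; linarith

/-- The de Bruijn identity along the path, integrated over a compact interval of times. -/
lemma pathEntropy_eq_add (hα : 1 / 2 ≤ α) (hlam : 0 < lam) (hμ : ∀ᵐ x ∂μ, 0 < x)
    (hint : Integrable (fun x => x ^ (α + 4)) μ) {a b : ℝ} (ha : 0 < a) (hab : a ≤ b) :
    pathEntropy α lam μ b = pathEntropy α lam μ a +
      ∫⁻ r in Ioc a b, ∫⁻ u in Ioi (0 : ℝ), ENNReal.ofReal (production α lam μ r u) := by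
  obtain ⟨C, -, hC⟩ := exists_abs_flux_le hα hlam hμ hint ha hab
  have hα0 : 0 < α := by linarith
  have hpos : ∀ r ∈ Icc a b, 0 < r := fun r hr => ha.trans_le hr.1
  have hsub : Icc a b ×ˢ Ioi (0 : ℝ) ⊆ Ioi 0 ×ˢ Ioi 0 :=
    prod_mono (fun r hr => hpos r hr) subset_rfl
  refine balance_halfLine (F := fun r u => klFun (relDensity α lam μ r u) * gammaPDFReal α lam u)
    (S := flux α lam μ) (T := entropyRate α lam μ) (K := production α lam μ) hab
    (fun r hr u hu => hasDerivAt_entropyDensity_time hα hlam (hpos r hr) hμ hu)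
    (fun r hr u hu => hasDerivAt_flux hα hlam (hpos r hr) hμ hu) (fun r hr => ?_)
    ((continuousOn_entropyRate hα hlam hμ).mono hsub)
    ((continuousOn_production hα hlam hμ).mono hsub)
    (fun r hr u hu => mul_nonneg (klFun_nonneg (relDensity_pos hα hlam (hpos r hr) hμ hu.le).le)
      (gammaPDFReal_nonneg hα0 hlam u)) (fun r hr u hu => ?_) hC ?_ ?_
  · refine ContinuousOn.mul (continuous_klFun.comp_continuousOn fun u _ => ?_)
      (continuousOn_gammaPDFReal α lam)
    exact (hasDerivAt_relDensity_space hα hlam (hpos r hr) hμ u).continuousAt.continuousWithinAt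
  · have h1 := hpos r hr
    have h2 := relDensity_pos hα hlam h1 hμ hu.le
    have h3 := gammaPDFReal_nonneg hα0 hlam u
    unfold production
    positivity
  · have h1 : Tendsto (fun u : ℝ => C * u ^ α) (𝓝[>] 0) (𝓝 0) := by
      have := ((Real.continuousAt_rpow_const 0 α (Or.inr hα0.le)).tendsto.const_mul C).mono_left
        (nhdsWithin_le_nhds (s := Ioi (0 : ℝ)))
      rwa [Real.zero_rpow hα0.ne', mul_zero] at this
    refine h1.congr' ?_
    filter_upwards [mem_nhdsWithin_of_mem_nhds (Iic_mem_nhds zero_lt_one)] with u hu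
    rw [if_pos (mem_Iic.1 hu)]
  · have h1 : Tendsto (fun u : ℝ => C * u ^ (-2 : ℝ)) atTop (𝓝 0) := by
      have := (tendsto_rpow_neg_atTop (zero_lt_two' ℝ)).const_mul C
      rwa [mul_zero] at this
    refine h1.congr' ?_
    filter_upwards [eventually_gt_atTop 1] with u hu
    rw [if_neg (not_le.2 hu)]

end

/-! ### The entropy at the two ends of the path -/

section

variable {μ : Measure ℝ} [IsProbabilityMeasure μ] {α lam : ℝ}

lemma tendsto_lap_zero (hα : 1 / 2 ≤ α) (hlam : 0 < lam) (hμ : ∀ᵐ x ∂μ, 0 < x)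
    (u : ℝ) : Tendsto (fun r => lap lam μ α 0 r u) (𝓝[>] 0) (𝓝 1) := by
  have h1 : ∫ x, lapKernel lam α 0 0 u x ∂μ = 1 := by
    simp [lapKernel, bes_zero (by linarith : 0 < α)]
  rw [← h1]
  refine tendsto_integral_filter_of_dominated_convergence
    (fun _ => Real.exp (2 * ((1 + lam) * |u|)))
    (Eventually.of_forall fun r => (measurable_lapKernel hα lam 0 r u).aestronglyMeasurable)
    ?_ (integrable_const _) (ae_of_all _ fun x => ?_)
  · filter_upwards [self_mem_nhdsWithin, mem_nhdsWithin_of_mem_nhds (Iic_mem_nhds zero_lt_one)]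
      with r (hr : 0 < r) (hr1 : r ≤ 1)
    filter_upwards [hμ] with x hx
    simpa using abs_lapKernel_le_of_le hlam hα hr le_rfl hr1 (le_refl |u|) hx.le 0
  · exact (((continuous_lapKernel hα lam 0).comp
      (by fun_prop : Continuous fun r : ℝ => (r, u, x))).tendsto 0).mono_left nhdsWithin_le_nhds

lemma tendsto_relDensity_zero (hα : 1 / 2 ≤ α) (hlam : 0 < lam) (hμ : ∀ᵐ x ∂μ, 0 < x)
    (u : ℝ) : Tendsto (fun r => relDensity α lam μ r u) (𝓝[>] 0) (𝓝 1) := by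
  have h1 : Tendsto (fun r : ℝ => ((r + lam) / lam) ^ α) (𝓝[>] 0) (𝓝 1) := by
    have h : ContinuousAt (fun r : ℝ => ((r + lam) / lam) ^ α) 0 :=
      ContinuousAt.rpow_const (by fun_prop) (Or.inl (by simp [hlam.ne']))
    have := h.tendsto.mono_left (nhdsWithin_le_nhds (s := Ioi 0))
    simpa [hlam.ne'] using this
  have h2 : Tendsto (fun r : ℝ => Real.exp (-(r * u))) (𝓝[>] 0) (𝓝 1) := by
    have h : Continuous fun r : ℝ => Real.exp (-(r * u)) := by fun_prop
    have := (h.tendsto 0).mono_left (nhdsWithin_le_nhds (s := Ioi 0))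
    simpa using this
  simpa [relDensity] using h1.mul (h2.mul (tendsto_lap_zero hα hlam hμ u))

lemma measurable_relDensity (hα : 1 / 2 ≤ α) (hlam : 0 < lam) {r : ℝ} (hr : 0 < r)
    (hμ : ∀ᵐ x ∂μ, 0 < x) : Measurable (relDensity α lam μ r) :=
  (continuous_iff_continuousAt.2 fun u =>
    (hasDerivAt_relDensity_space hα hlam hr hμ u).continuousAt).measurable

/-- The entropy vanishes at the initial time, where the path has the gamma law. For `r ≤ 1` the
entropy density is dominated by a multiple of the gamma density near the origin; for `u > 1` the
decay of the mixed moments, with one power of `u` lost to the logarithm, leaves `u ^ (-3)`. -/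
lemma tendsto_pathEntropy_zero (hα : 1 / 2 ≤ α) (hlam : 0 < lam) (hμ : ∀ᵐ x ∂μ, 0 < x)
    (hint : Integrable (fun x => x ^ (α + 4)) μ) :
    Tendsto (pathEntropy α lam μ) (𝓝[>] 0) (𝓝 0) := by
  have hα0 : 0 < α := by linarith
  obtain ⟨L, hL0, hL⟩ := exists_abs_log_relDensity_le hα hlam one_pos hμ
  obtain ⟨D, hD0, hD⟩ := exists_lap_decay hα hlam hμ hint
  set A := ((1 + lam) / lam) ^ α with hA
  have hA0 : 0 ≤ A := by positivity
  set c := lam ^ α / Real.Gamma α with hc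
  have hc0 : 0 < c := by
    have := Real.Gamma_pos_of_pos hα0
    positivity
  set C₁ := A * Real.exp lam * (L * 2) + 1 with hC₁
  set C₂ := L * 2 * (A * c * D) with hC₂
  have hC₁0 : 0 ≤ C₁ := by positivity
  have hC₂0 : 0 ≤ C₂ := by positivity
  have hzero : ∫⁻ u in Ioi (0 : ℝ), ENNReal.ofReal (klFun 1 * gammaPDFReal α lam u) = 0 := by
    simp [klFun_one]
  rw [← hzero]
  refine tendsto_lintegral_filter_of_dominated_convergence
    (fun u => ENNReal.ofReal C₁ * gammaPDF α lam u +
      (Ioi (1 : ℝ)).indicator (fun u => ENNReal.ofReal (C₂ * u ^ (-3 : ℝ))) u) ?_ ?_ ?_ ?_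
  · filter_upwards [self_mem_nhdsWithin] with r (hr : 0 < r)
    exact ((measurable_klFun.comp (measurable_relDensity hα hlam hr hμ)).mul
      (measurable_gammaPDFReal α lam)).ennreal_ofReal
  · filter_upwards [self_mem_nhdsWithin, mem_nhdsWithin_of_mem_nhds (Iic_mem_nhds zero_lt_one)]
      with r (hr : 0 < r) (hr1 : r ≤ 1)
    filter_upwards [ae_restrict_mem measurableSet_Ioi] with u (hu : 0 < u)
    have hg := gammaPDFReal_nonneg hα0 hlam u
    have hh := relDensity_pos hα hlam hr hμ hu.le
    have hAr : ((r + lam) / lam) ^ α ≤ A := by rw [hA]; gcongr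
    have hk : klFun (relDensity α lam μ r u) ≤ relDensity α lam μ r u * (L * (1 + u)) + 1 := by
      have h1 := (le_abs_self _).trans (hL r hr hr1 u hu.le)
      have h2 := mul_le_mul_of_nonneg_left h1 hh.le
      rw [klFun_apply]
      linarith
    rcases le_or_gt u 1 with hu1 | hu1
    · rw [indicator_of_notMem (by simpa using hu1), add_zero, gammaPDF,
        ← ENNReal.ofReal_mul hC₁0]
      refine ENNReal.ofReal_le_ofReal (mul_le_mul_of_nonneg_right (hk.trans ?_) hg)
      have h3 : relDensity α lam μ r u ≤ A * Real.exp lam := by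
        refine (relDensity_le hα hlam hr hμ hu.le).trans ?_
        have : lam * u ≤ lam := mul_le_of_le_one_right hlam.le hu1
        gcongr
      have h4 : L * (1 + u) ≤ L * 2 := by gcongr; linarith
      rw [hC₁]
      gcongr
    · rw [indicator_of_mem (by exact hu1), gammaPDF, ← ENNReal.ofReal_mul hC₁0,
        ← ENNReal.ofReal_add (by positivity) (by positivity)]
      refine ENNReal.ofReal_le_ofReal ?_
      have h5 : relDensity α lam μ r u * gammaPDFReal α lam u ≤ A * c * D * u ^ (-4 : ℝ) := by
        have d0 := hD 0 zero_le_one r hr u hu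
        rw [show -((r + lam) * u) = -(r * u) + -(lam * u) by ring, Real.exp_add] at d0
        have l0 := lap_nonneg hlam hα hr hμ 0 hu.le
        calc relDensity α lam μ r u * gammaPDFReal α lam u
            = ((r + lam) / lam) ^ α * c * u ^ (α - 1) * (Real.exp (-(r * u)) *
                Real.exp (-(lam * u)) * lap lam μ α 0 r u) := by
              rw [relDensity, gammaPDFReal_of_pos hu, ← hc]; ring
          _ ≤ A * c * u ^ (α - 1) * (D * u ^ (-(α + 3))) := by gcongr
          _ = A * c * D * (u ^ (α - 1) * u ^ (-(α + 3))) := by ring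
          _ = _ := by rw [← Real.rpow_add hu]; congr 2; ring
      have h6 : u ^ (-4 : ℝ) * u = u ^ (-3 : ℝ) := by
        rw [← Real.rpow_add_one hu.ne']; norm_num
      have h7 : L * (1 + u) ≤ L * (2 * u) := by gcongr; linarith
      have h8 : 1 ≤ C₁ := by rw [hC₁]; linarith [show 0 ≤ A * Real.exp lam * (L * 2) by positivity]
      calc klFun (relDensity α lam μ r u) * gammaPDFReal α lam u
          ≤ (relDensity α lam μ r u * (L * (1 + u)) + 1) * gammaPDFReal α lam u := by gcongr
        _ = (L * (1 + u)) * (relDensity α lam μ r u * gammaPDFReal α lam u) +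
              1 * gammaPDFReal α lam u := by ring
        _ ≤ (L * (2 * u)) * (A * c * D * u ^ (-4 : ℝ)) + C₁ * gammaPDFReal α lam u := by gcongr
        _ = C₁ * gammaPDFReal α lam u + C₂ * (u ^ (-4 : ℝ) * u) := by rw [hC₂]; ring
        _ = _ := by rw [h6]
  · have hm : Measurable fun u => ENNReal.ofReal C₁ * gammaPDF α lam u :=
      (measurable_gammaPDF α lam).const_mul _
    rw [lintegral_add_left hm, lintegral_const_mul _ (measurable_gammaPDF α lam)]
    refine ENNReal.add_ne_top.2 ⟨ENNReal.mul_ne_top ENNReal.ofReal_ne_top ?_, ?_⟩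
    · refine ne_top_of_le_ne_top ENNReal.one_ne_top ?_
      rw [← lintegral_gammaPDF_eq_one hα0 hlam]
      exact setLIntegral_le_lintegral _ _
    · refine ne_top_of_le_ne_top ?_ (setLIntegral_le_lintegral _ _)
      rw [lintegral_indicator measurableSet_Ioi]
      have h9 : IntegrableOn (fun u : ℝ => C₂ * u ^ (-3 : ℝ)) (Ioi 1) :=
        (integrableOn_Ioi_rpow_of_lt (by norm_num) one_pos).const_mul _
      refine (lintegral_ofReal_ne_top_iff_integrable h9.aestronglyMeasurable ?_).2 h9
      filter_upwards [ae_restrict_mem measurableSet_Ioi] with u (hu : 1 < u)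
      have : 0 < u := by linarith
      change 0 ≤ C₂ * u ^ (-3 : ℝ)
      positivity
  · filter_upwards [ae_restrict_mem measurableSet_Ioi] with u _
    exact ENNReal.tendsto_ofReal (((continuous_klFun.tendsto 1).comp
      (tendsto_relDensity_zero hα hlam hμ u)).mul_const _)

lemma pathEntropy_eq_lintegral_gammaMeasure (hα : 1 / 2 ≤ α) (hlam : 0 < lam) {r : ℝ} (hr : 0 < r)
    (hμ : ∀ᵐ x ∂μ, 0 < x) : pathEntropy α lam μ r =
      ∫⁻ u, ENNReal.ofReal (klFun (relDensity α lam μ r u)) ∂(gammaMeasure α lam) := by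
  have hm : Measurable fun u => ENNReal.ofReal (klFun (relDensity α lam μ r u)) :=
    (measurable_klFun.comp (measurable_relDensity hα hlam hr hμ)).ennreal_ofReal
  rw [lintegral_gammaMeasure _ hm.aemeasurable]
  refine setLIntegral_congr_fun measurableSet_Ioi fun u (hu : 0 < u) => ?_
  rw [← ENNReal.ofReal_mul (gammaPDFReal_nonneg (by linarith) hlam u), mul_comm]

/-- The entropy along the path is at most the entropy of the law `μ` at the final time. -/
lemma pathEntropy_le_klDiv (hα : 1 / 2 ≤ α) (hlam : 0 < lam) {r : ℝ} (hr : 0 < r)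
    (hμ : ∀ᵐ x ∂μ, 0 < x) : pathEntropy α lam μ r ≤ klDiv μ (gammaMeasure α lam) := by
  have := isProbabilityMeasure_gammaMeasure (by linarith : 0 < α) hlam
  have := isProbabilityMeasure_pathLaw (by linarith : 0 < α) hlam hr μ
  refine le_trans (le_of_eq ?_) (klDiv_pathLaw_le hα hlam hr μ)
  have hm := (measurable_relDensity hα hlam hr hμ).ennreal_ofReal
  rw [klDiv_eq_lintegral_klFun_of_ac (by
    rw [pathLaw_eq_withDensity_relDensity hα hlam hr hμ]
    exact withDensity_absolutelyContinuous _ _),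
    pathEntropy_eq_lintegral_gammaMeasure hα hlam hr hμ]
  refine lintegral_congr_ae ?_
  rw [pathLaw_eq_withDensity_relDensity hα hlam hr hμ]
  filter_upwards [Measure.rnDeriv_withDensity (gammaMeasure α lam) hm, gammaMeasure_ae_pos α lam]
    with u hu hu0
  rw [hu, ENNReal.toReal_ofReal (relDensity_pos hα hlam hr hμ hu0.le).le]

end

/-! ### A variational bound for the relative entropy -/

section

lemma abs_exp_sub_exp_le {a b M : ℝ} (ha : a ≤ M) (hb : b ≤ M) :
    |Real.exp a - Real.exp b| ≤ Real.exp M * |a - b| := by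
  wlog h : b ≤ a generalizing a b
  · rw [abs_sub_comm, abs_sub_comm a]
    exact this hb ha (le_of_not_ge h)
  rw [abs_of_nonneg (sub_nonneg.2 (Real.exp_le_exp.2 h)), abs_of_nonneg (sub_nonneg.2 h)]
  have h1 : Real.exp a - Real.exp b = Real.exp a * (1 - Real.exp (b - a)) := by
    rw [mul_sub, ← Real.exp_add]; ring_nf
  have h2 : 1 - Real.exp (b - a) ≤ a - b := by linarith [Real.add_one_le_exp (b - a)]
  rw [h1]
  have h3 : Real.exp a ≤ Real.exp M := Real.exp_le_exp.2 ha
  have h4 := Real.exp_pos a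
  calc Real.exp a * (1 - Real.exp (b - a)) ≤ Real.exp a * (a - b) := by gcongr
    _ ≤ Real.exp M * (a - b) := by gcongr

lemma abs_clamp_sub_clamp_le {a b M : ℝ} :
    |max (-M) (min a M) - max (-M) (min b M)| ≤ |a - b| :=
  (abs_max_sub_max_le_max _ _ _ _).trans (max_le (by simp)
    ((abs_min_sub_min_le_max _ _ _ _).trans (by simp)))

/-- A variational inequality for bounded continuous functions extends to bounded measurable ones,
by approximation in `L¹`. -/
lemma variational_of_boundedContinuous {μ ν : Measure ℝ} [IsProbabilityMeasure μ]
    [IsProbabilityMeasure ν] {C : ℝ}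
    (h : ∀ g : ℝ →ᵇ ℝ, ∫ x, g x ∂μ ≤ C + ∫ x, (Real.exp (g x) - 1) ∂ν)
    {f : ℝ → ℝ} (hf : Measurable f) {M : ℝ} (hM : ∀ x, |f x| ≤ M) :
    ∫ x, f x ∂μ ≤ C + ∫ x, (Real.exp (f x) - 1) ∂ν := by
  have hM0 : 0 ≤ M := (abs_nonneg _).trans (hM 0)
  have hclamp : ∀ x, max (-M) (min (f x) M) = f x := fun x => by
    have := abs_le.1 (hM x)
    rw [min_eq_left this.2, max_eq_right this.1]
  have iE : ∀ {k : ℝ → ℝ}, Measurable k → (∀ x, |k x| ≤ M) → ∀ (ρ : Measure ℝ) [IsFiniteMeasure ρ],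
      Integrable k ρ ∧ Integrable (fun x => Real.exp (k x) - 1) ρ := by
    intro k hk hkM ρ _
    refine ⟨Integrable.of_bound hk.aestronglyMeasurable M (ae_of_all _ hkM), ?_⟩
    refine (Integrable.of_bound hk.exp.aestronglyMeasurable (Real.exp M)
      (ae_of_all _ fun x => ?_)).sub (integrable_const _)
    rw [Real.norm_eq_abs, Real.abs_exp]
    exact Real.exp_le_exp.2 ((le_abs_self _).trans (hkM x))
  refine le_of_forall_pos_le_add fun ε hε => ?_
  set ε' := ε / (1 + Real.exp M) with hε'
  have hε'0 : 0 < ε' := by positivity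
  obtain ⟨g₀, hg₀, hg₀i⟩ :=
    (iE hf hM (μ + ν)).1.exists_boundedContinuous_integral_sub_le hε'0
  -- clamping the approximation to `[-M, M]` makes `exp` Lipschitz with constant `exp M`
  let g : ℝ →ᵇ ℝ := BoundedContinuousFunction.ofNormedAddCommGroup
    (fun x => max (-M) (min (g₀ x) M)) (by fun_prop) M fun x => by
      rw [Real.norm_eq_abs, abs_le]
      exact ⟨le_max_left _ _, max_le (by linarith) (min_le_right _ _)⟩
  have hg : ∀ x, g x = max (-M) (min (g₀ x) M) := fun x => rfl
  have hgM : ∀ x, |g x| ≤ M := fun x => by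
    rw [hg, abs_le]
    exact ⟨le_max_left _ _, max_le (by linarith) (min_le_right _ _)⟩
  have hgm : Measurable g := g.continuous.measurable
  have hfg : ∀ x, |f x - g x| ≤ ‖f x - g₀ x‖ := fun x => by
    rw [Real.norm_eq_abs, hg]
    conv_lhs => rw [← hclamp x]
    exact abs_clamp_sub_clamp_le
  have hi : Integrable (fun x => ‖f x - g₀ x‖) (μ + ν) := ((iE hf hM (μ + ν)).1.sub hg₀i).norm
  have hiμ := hi.left_of_add_measure
  have hiν := hi.right_of_add_measure
  rw [integral_add_measure hiμ hiν] at hg₀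
  have h0μ : 0 ≤ ∫ x, ‖f x - g₀ x‖ ∂μ := integral_nonneg fun x => norm_nonneg _
  have h0ν : 0 ≤ ∫ x, ‖f x - g₀ x‖ ∂ν := integral_nonneg fun x => norm_nonneg _
  have h1 : ∫ x, f x ∂μ ≤ ∫ x, g x ∂μ + ε' := by
    have : ∫ x, f x ∂μ ≤ ∫ x, (g x + ‖f x - g₀ x‖) ∂μ := by
      refine integral_mono (iE hf hM μ).1 ((iE hgm hgM μ).1.add hiμ) fun x => ?_
      have := (le_abs_self _).trans (hfg x)
      linarith
    rw [integral_add (iE hgm hgM μ).1 hiμ] at this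
    linarith
  have h2 : ∫ x, (Real.exp (g x) - 1) ∂ν ≤ ∫ x, (Real.exp (f x) - 1) ∂ν + Real.exp M * ε' := by
    have : ∫ x, (Real.exp (g x) - 1) ∂ν ≤
        ∫ x, ((Real.exp (f x) - 1) + Real.exp M * ‖f x - g₀ x‖) ∂ν := by
      refine integral_mono (iE hgm hgM ν).2 ((iE hf hM ν).2.add (hiν.const_mul _)) fun x => ?_
      have h3 := (le_abs_self _).trans (abs_exp_sub_exp_le ((le_abs_self _).trans (hgM x))
        ((le_abs_self _).trans (hM x)))
      have h4 : |g x - f x| ≤ ‖f x - g₀ x‖ := by rw [abs_sub_comm]; exact hfg x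
      have h5 := mul_le_mul_of_nonneg_left h4 (Real.exp_pos M).le
      change _ ≤ (Real.exp (f x) - 1) + Real.exp M * ‖f x - g₀ x‖
      linarith
    rw [integral_add (iE hf hM ν).2 (hiν.const_mul _), integral_const_mul] at this
    have h6 : Real.exp M * ∫ x, ‖f x - g₀ x‖ ∂ν ≤ Real.exp M * ε' := by gcongr; linarith
    linarith
  have h3 : ε' + Real.exp M * ε' = ε := by rw [hε']; field_simp
  have := h g
  linarith

/-- Truncation of `t` to `[1 / (n + 1), n + 1]`. -/
def truncate (n : ℕ) (t : ℝ) : ℝ := max (1 / (n + 1)) (min t (n + 1))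

lemma truncate_pos (n : ℕ) (t : ℝ) : 0 < truncate n t :=
  lt_max_of_lt_left (by positivity)

lemma abs_log_truncate_le (n : ℕ) (t : ℝ) : |Real.log (truncate n t)| ≤ Real.log (n + 1) := by
  have hn : (0 : ℝ) ≤ n := n.cast_nonneg
  have h1 : truncate n t ≤ n + 1 :=
    max_le (by rw [div_le_iff₀ (by positivity)]; nlinarith) (min_le_right _ _)
  have h2 : 1 / ((n : ℝ) + 1) ≤ truncate n t := le_max_left _ _
  rw [abs_le]
  constructor
  · rw [← Real.log_inv, ← one_div]
    exact Real.log_le_log (by positivity) h2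
  · exact Real.log_le_log (truncate_pos n t) h1

lemma mul_log_truncate_nonneg (n : ℕ) (t : ℝ) :
    0 ≤ (t - truncate n t) * Real.log (truncate n t) := by
  have hn : (0 : ℝ) ≤ n := n.cast_nonneg
  have h0 : 1 / ((n : ℝ) + 1) ≤ 1 := by rw [div_le_one (by positivity)]; linarith
  rcases le_total t (1 / (n + 1)) with h | h
  · have e : truncate n t = 1 / (n + 1) := max_eq_left (min_le_of_left_le h)
    rw [e]
    exact mul_nonneg_of_nonpos_of_nonpos (by linarith)
      (Real.log_nonpos (by positivity) h0)
  · rcases le_total t (n + 1) with h' | h'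
    · have e : truncate n t = t := by rw [truncate, min_eq_left h', max_eq_right h]
      simp [e]
    · have e : truncate n t = n + 1 := by
        rw [truncate, min_eq_right h', max_eq_right (by linarith)]
      rw [e]
      exact mul_nonneg (by linarith) (Real.log_nonneg (by linarith))

lemma tendsto_truncate {t : ℝ} (ht : 0 ≤ t) : Tendsto (fun n => truncate n t) atTop (𝓝 t) := by
  have h1 : Tendsto (fun n : ℕ => min t ((n : ℝ) + 1)) atTop (𝓝 t) := by
    refine tendsto_const_nhds.congr' ?_
    filter_upwards [(tendsto_natCast_atTop_atTop (R := ℝ)).eventually_ge_atTop t] with n hn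
    rw [min_eq_left (by linarith)]
  have := (tendsto_one_div_add_atTop_nhds_zero_nat (𝕜 := ℝ)).max h1
  rwa [max_eq_right ht] at this

/-- One half of the Donsker–Varadhan formula, in the form dual to `klFun`: a bound for
`∫ g dμ - ∫ (exp g - 1) dν` over all bounded continuous `g` bounds the relative entropy. The
optimal `g` is the logarithm of the density, which is truncated here. -/
lemma klDiv_le_of_forall_boundedContinuous {μ ν : Measure ℝ} [IsProbabilityMeasure μ]
    [IsProbabilityMeasure ν] {C : ℝ}
    (h : ∀ g : ℝ →ᵇ ℝ, ∫ x, g x ∂μ ≤ C + ∫ x, (Real.exp (g x) - 1) ∂ν) :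
    klDiv μ ν ≤ ENNReal.ofReal C := by
  -- test functions `n 1_A` with `ν A = 0` force `n μ(A) ≤ C` for all `n`
  have hac : μ ≪ ν := by
    refine Measure.AbsolutelyContinuous.mk fun A hA hνA => ?_
    have h1 : ∀ n : ℕ, n * μ.real A ≤ C := by
      intro n
      have := variational_of_boundedContinuous h (f := A.indicator fun _ => (n : ℝ))
        (measurable_const.indicator hA) (M := n) (fun x => by
          by_cases hx : x ∈ A <;> simp [hx])
      rw [integral_indicator_const _ hA, smul_eq_mul] at this
      have h2 : ∫ x, (Real.exp (A.indicator (fun _ => (n : ℝ)) x) - 1) ∂ν = 0 := by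
        refine integral_eq_zero_of_ae ?_
        filter_upwards [measure_eq_zero_iff_ae_notMem.1 hνA] with x hx
        simp [hx]
      rw [h2] at this
      linarith
    by_contra hne
    have hpos : 0 < μ.real A := ENNReal.toReal_pos hne (measure_ne_top _ _)
    obtain ⟨n, hn⟩ := exists_nat_gt (C / μ.real A)
    rw [div_lt_iff₀ hpos] at hn
    linarith [h1 n]
  rw [klDiv_eq_lintegral_klFun_of_ac hac]
  set f : ℝ → ℝ := fun x => (μ.rnDeriv ν x).toReal with hf
  have hfm : Measurable f := (Measure.measurable_rnDeriv μ ν).ennreal_toReal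
  have hf0 : ∀ x, 0 ≤ f x := fun x => ENNReal.toReal_nonneg
  have htm : ∀ n, Measurable fun x => truncate n (f x) := fun n => by
    unfold truncate; fun_prop
  -- the integrand of the variational formula for the test function `log (truncate n f)`; it is
  -- nonnegative and converges to `klFun f`, so that Fatou's lemma applies
  set G : ℕ → ℝ → ℝ := fun n x => f x * Real.log (truncate n (f x)) - (truncate n (f x) - 1) with hG
  have hG0 : ∀ n x, 0 ≤ G n x := by
    intro n x
    have h1 := mul_log_truncate_nonneg n (f x)
    have h2 := klFun_nonneg (truncate_pos n (f x)).le
    rw [klFun_apply] at h2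
    simp only [hG]
    linarith
  have hGm : ∀ n, Measurable (G n) := fun n =>
    (hfm.mul (htm n).log).sub ((htm n).sub measurable_const)
  have hGC : ∀ n, ∫⁻ x, ENNReal.ofReal (G n x) ∂ν ≤ ENNReal.ofReal C := by
    intro n
    have hb : ∀ x, |Real.log (truncate n (f x))| ≤ Real.log (n + 1) :=
      fun x => abs_log_truncate_le n _
    have h1 := variational_of_boundedContinuous h (htm n).log hb
    simp only [Real.exp_log (truncate_pos n _)] at h1
    have hfi : Integrable f ν := Measure.integrable_toReal_rnDeriv
    have i1 : Integrable (fun x => f x * Real.log (truncate n (f x))) ν :=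
      hfi.mul_bdd (htm n).log.aestronglyMeasurable (ae_of_all _ hb)
    have i2 : Integrable (fun x => truncate n (f x) - 1) ν := by
      refine Integrable.sub (Integrable.of_bound (htm n).aestronglyMeasurable ((n : ℝ) + 1)
        (ae_of_all _ fun x => ?_)) (integrable_const _)
      have hn : (0 : ℝ) ≤ n := n.cast_nonneg
      rw [Real.norm_of_nonneg (truncate_pos n _).le]
      exact max_le (by rw [div_le_iff₀ (by positivity)]; nlinarith) (min_le_right _ _)
    rw [← integral_rnDeriv_smul hac] at h1
    simp only [smul_eq_mul] at h1
    have iG : Integrable (G n) ν := i1.sub i2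
    rw [← ofReal_integral_eq_lintegral_ofReal iG (ae_of_all _ (hG0 n))]
    refine ENNReal.ofReal_le_ofReal ?_
    simp only [hG]
    rw [integral_sub i1 i2]
    linarith
  have hlim : ∀ x, Tendsto (fun n => ENNReal.ofReal (G n x)) atTop
      (𝓝 (ENNReal.ofReal (klFun (f x)))) := by
    intro x
    refine ENNReal.tendsto_ofReal ?_
    have ht := tendsto_truncate (hf0 x)
    have h1 : Tendsto (fun n => f x * Real.log (truncate n (f x))) atTop
        (𝓝 (f x * Real.log (f x))) := by
      rcases (hf0 x).eq_or_lt with h0 | h0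
      · simp [← h0]
      · exact (ht.log h0.ne').const_mul _
    rw [klFun_apply, add_sub_assoc, show f x * Real.log (f x) + (1 - f x) =
      f x * Real.log (f x) - (f x - 1) by ring]
    exact h1.sub (ht.sub_const 1)
  calc ∫⁻ x, ENNReal.ofReal (klFun (f x)) ∂ν
      = ∫⁻ x, liminf (fun n => ENNReal.ofReal (G n x)) atTop ∂ν :=
        lintegral_congr fun x => (hlim x).liminf_eq.symm
    _ ≤ liminf (fun n => ∫⁻ x, ENNReal.ofReal (G n x) ∂ν) atTop :=
        lintegral_liminf_le fun n => (hGm n).ennreal_ofReal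
    _ ≤ ENNReal.ofReal C := liminf_le_of_le (by isBoundedDefault) fun b hb => by
        obtain ⟨n, hn⟩ := hb.exists
        exact hn.trans (hGC n)

end

/-! ### Weak convergence at the final time -/

section

variable {μ : Measure ℝ} [IsProbabilityMeasure μ] {α lam : ℝ}

/-- The transition kernel of the path in the parameter `r = λ τ / (1 - τ)`. -/
def pathKernel (α lam r : ℝ) : Kernel ℝ ℝ := mixKernel α (r + lam) ∘ₖ poissonKernel r

lemma pathLaw_eq_comp (α lam r : ℝ) (μ : Measure ℝ) :
    pathLaw α lam r μ = pathKernel α lam r ∘ₘ μ := Measure.comp_assoc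

lemma isMarkovKernel_pathKernel (hα : 0 < α) (hlam : 0 < lam) {r : ℝ} (hr : 0 < r) :
    IsMarkovKernel (pathKernel α lam r) := by
  have := isMarkovKernel_poissonKernel r
  have := isMarkovKernel_mixKernel hα (by positivity : 0 < r + lam)
  unfold pathKernel
  infer_instance

/-- The Laplace transform of the transition kernel. -/
lemma lintegral_exp_pathKernel (hα : 0 < α) (hlam : 0 < lam) {r x θ : ℝ} (hr : 0 < r)
    (hx : 0 ≤ x) (hθ : 0 < θ) :
    ∫⁻ u, ENNReal.ofReal (Real.exp (-θ * u)) ∂(pathKernel α lam r x) =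
      ENNReal.ofReal (((r + lam) / (r + lam + θ)) ^ α *
        Real.exp (-(x * (r / (r + (lam + θ)) * θ)))) := by
  have hs : 0 < r + lam := by positivity
  have hq : 0 < (r + lam) / (r + lam + θ) := by positivity
  rw [pathKernel, Kernel.lintegral_comp _ _ _ (by fun_prop)]
  have h1 : ∀ k : ℕ, ∫⁻ u, ENNReal.ofReal (Real.exp (-θ * u)) ∂(mixKernel α (r + lam) k) =
      ENNReal.ofReal (((r + lam) / (r + lam + θ)) ^ α * ((r + lam) / (r + lam + θ)) ^ k) := by
    intro k
    have := lintegral_exp_gammaMeasure (a := α + k) (t := -θ) (by positivity) hs (by linarith)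
    rwa [sub_neg_eq_add, Real.rpow_add hq, Real.rpow_natCast] at this
  simp only [h1]
  rw [lintegral_poissonKernel hr.le hx]
  have h2 := ((NormedSpace.expSeries_div_hasSum_exp
    (x * r * ((r + lam) / (r + lam + θ)))).mul_left
      (((r + lam) / (r + lam + θ)) ^ α * Real.exp (-(x * r))))
  rw [← Real.exp_eq_exp_ℝ] at h2
  have h3 : ∀ k : ℕ, ((r + lam) / (r + lam + θ)) ^ α * Real.exp (-(x * r)) *
      ((x * r * ((r + lam) / (r + lam + θ))) ^ k / k.factorial) =
        Real.exp (-(x * r)) * (x * r) ^ k / k.factorial *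
          (((r + lam) / (r + lam + θ)) ^ α * ((r + lam) / (r + lam + θ)) ^ k) := by
    intro k
    rw [mul_pow]
    ring
  have h4 : ((r + lam) / (r + lam + θ)) ^ α * Real.exp (-(x * (r / (r + (lam + θ)) * θ))) =
      ((r + lam) / (r + lam + θ)) ^ α * Real.exp (-(x * r)) *
        Real.exp (x * r * ((r + lam) / (r + lam + θ))) := by
    rw [mul_assoc, ← Real.exp_add]
    congr 2
    field_simp
    ring
  rw [h4, ← h2.tsum_eq, ENNReal.ofReal_tsum_of_nonneg (fun k => by positivity) h2.summable]
  refine tsum_congr fun k => ?_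
  rw [h3]
  exact (ENNReal.ofReal_mul (by positivity)).symm

lemma tendsto_div_add_atTop (c : ℝ) : Tendsto (fun r : ℝ => r / (r + c)) atTop (𝓝 1) := by
  have h1 : Tendsto (fun r : ℝ => 1 - c * (r + c)⁻¹) atTop (𝓝 (1 - c * 0)) :=
    ((tendsto_inv_atTop_zero.comp (tendsto_atTop_add_const_right _ c tendsto_id)).const_mul
      c).const_sub 1
  rw [mul_zero, sub_zero] at h1
  refine h1.congr' ?_
  filter_upwards [eventually_gt_atTop (-c)] with r hr
  have : r + c ≠ 0 := by linarith
  field_simp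
  ring

/-- The Laplace transform of the kernel from `x` converges to that of the unit mass at `x`. -/
lemma tendsto_integral_exp_pathKernel (hα : 0 < α) (hlam : 0 < lam) {x θ : ℝ} (hx : 0 ≤ x)
    (hθ : 0 < θ) :
    Tendsto (fun r => ∫ u, Real.exp (-θ * u) ∂(pathKernel α lam r x)) atTop
      (𝓝 (Real.exp (-θ * x))) := by
  have h1 : Tendsto (fun r : ℝ => (r + lam) / (r + lam + θ)) atTop (𝓝 1) :=
    (tendsto_div_add_atTop θ).comp (tendsto_atTop_add_const_right _ lam tendsto_id)
  have h2 : Tendsto (fun r : ℝ => ((r + lam) / (r + lam + θ)) ^ α *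
      Real.exp (-(x * (r / (r + (lam + θ)) * θ)))) atTop
        (𝓝 ((1 : ℝ) ^ α * Real.exp (-(x * (1 * θ))))) :=
    (h1.rpow_const (Or.inl one_ne_zero)).mul ((Real.continuous_exp.tendsto _).comp
      ((((tendsto_div_add_atTop (lam + θ)).mul_const θ).const_mul x).neg))
  rw [Real.one_rpow, one_mul, one_mul, show -(x * θ) = -θ * x by ring] at h2
  refine h2.congr' ?_
  filter_upwards [eventually_gt_atTop 0] with r hr
  rw [integral_eq_lintegral_of_nonneg_ae (ae_of_all _ fun u => (Real.exp_pos _).le) (by fun_prop),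
    lintegral_exp_pathKernel hα hlam hr hx hθ, ENNReal.toReal_ofReal (by positivity)]

lemma integrable_exp_pathKernel (hα : 0 < α) (hlam : 0 < lam) {r x θ : ℝ} (hr : 0 < r)
    (hx : 0 ≤ x) (hθ : 0 < θ) : Integrable (fun u => Real.exp (-θ * u)) (pathKernel α lam r x) := by
  refine (lintegral_ofReal_ne_top_iff_integrable (by fun_prop)
    (ae_of_all _ fun u => (Real.exp_pos _).le)).1 ?_
  rw [lintegral_exp_pathKernel hα hlam hr hx hθ]
  exact ENNReal.ofReal_ne_top

/-- A bounded continuous function oscillates around `g x` by at most `ε` plus a multiple of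
`(exp (-u) - exp (-x))²`. -/
lemma exists_abs_sub_le_sq (g : ℝ →ᵇ ℝ) (x : ℝ) {ε : ℝ} (hε : 0 < ε) : ∃ D : ℝ, 0 ≤ D ∧
    ∀ u, |g u - g x| ≤ ε + D * (Real.exp (-u) - Real.exp (-x)) ^ 2 := by
  obtain ⟨δ, hδ, hg⟩ := Metric.continuousAt_iff.1 (g.continuous.continuousAt (x := x)) ε hε
  set c₁ := Real.exp (-x) - Real.exp (-(x + δ)) with hc₁
  set c₂ := Real.exp (-(x - δ)) - Real.exp (-x) with hc₂
  have h1 : 0 < c₁ := sub_pos.2 (Real.exp_lt_exp.2 (by linarith))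
  have h2 : 0 < c₂ := sub_pos.2 (Real.exp_lt_exp.2 (by linarith))
  set c := min c₁ c₂ with hc
  have hc0 : 0 < c := lt_min h1 h2
  refine ⟨2 * ‖g‖ / c ^ 2, by positivity, fun u => ?_⟩
  by_cases hu : dist u x < δ
  · have := (hg hu).le
    rw [Real.dist_eq] at this
    have h3 : 0 ≤ 2 * ‖g‖ / c ^ 2 * (Real.exp (-u) - Real.exp (-x)) ^ 2 := by positivity
    linarith
  · have h3 : |g u - g x| ≤ 2 * ‖g‖ := by
      have := g.dist_le_two_norm u x
      rwa [Real.dist_eq] at this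
    have h4 : c ≤ |Real.exp (-u) - Real.exp (-x)| := by
      rw [Real.dist_eq, not_lt, le_abs] at hu
      rcases hu with hu | hu
      · have : Real.exp (-u) ≤ Real.exp (-(x + δ)) := Real.exp_le_exp.2 (by linarith)
        exact (min_le_left _ _).trans (le_abs.2 (Or.inr (by linarith)))
      · have : Real.exp (-(x - δ)) ≤ Real.exp (-u) := Real.exp_le_exp.2 (by linarith)
        exact (min_le_right _ _).trans (le_abs.2 (Or.inl (by linarith)))
    have h5 : c ^ 2 ≤ (Real.exp (-u) - Real.exp (-x)) ^ 2 := by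
      rw [← sq_abs (Real.exp (-u) - Real.exp (-x))]
      gcongr
    have h6 : 2 * ‖g‖ ≤ 2 * ‖g‖ / c ^ 2 * (Real.exp (-u) - Real.exp (-x)) ^ 2 := by
      rw [div_mul_eq_mul_div, le_div_iff₀ (by positivity)]
      gcongr
    linarith

lemma exp_neg_sub_sq (u e : ℝ) : (Real.exp (-u) - e) ^ 2 =
    Real.exp (-2 * u) + (-2 * e) * Real.exp (-1 * u) + e ^ 2 := by
  have : Real.exp (-2 * u) = Real.exp (-u) ^ 2 := by
    rw [← Real.exp_nat_mul]; congr 1; push_cast; ring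
  rw [this, neg_one_mul]
  ring

lemma integral_exp_neg_sub_sq {ν : Measure ℝ} [IsProbabilityMeasure ν]
    (h1 : Integrable (fun u => Real.exp (-1 * u)) ν)
    (h2 : Integrable (fun u => Real.exp (-2 * u)) ν) (e : ℝ) :
    Integrable (fun u => (Real.exp (-u) - e) ^ 2) ν ∧ ∫ u, (Real.exp (-u) - e) ^ 2 ∂ν =
      (∫ u, Real.exp (-2 * u) ∂ν) + (-2 * e) * (∫ u, Real.exp (-1 * u) ∂ν) + e ^ 2 := by
  simp only [exp_neg_sub_sq]
  have h3 := h1.const_mul (-2 * e)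
  refine ⟨(h2.add h3).add (integrable_const _), ?_⟩
  have h4 : Integrable (fun u => Real.exp (-2 * u) + (-2 * e) * Real.exp (-1 * u)) ν := h2.add h3
  rw [integral_add h4 (integrable_const _), integral_add h2 h3, integral_const_mul]
  simp

/-- The kernel converges weakly to the unit mass: by the convergence of the Laplace transforms at
`1` and `2`, the variable `exp (-U)` converges in `L²` to the constant `exp (-x)`. -/
lemma tendsto_integral_pathKernel (hα : 0 < α) (hlam : 0 < lam) {x : ℝ} (hx : 0 ≤ x)
    (g : ℝ →ᵇ ℝ) : Tendsto (fun r => ∫ u, g u ∂(pathKernel α lam r x)) atTop (𝓝 (g x)) := by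
  refine Metric.tendsto_nhds.2 fun ε hε => ?_
  obtain ⟨D, hD0, hD⟩ := exists_abs_sub_le_sq g x (half_pos hε)
  have hlim : Tendsto (fun r => ε / 2 + D * ((∫ u, Real.exp (-2 * u) ∂(pathKernel α lam r x)) +
      (-2 * Real.exp (-x)) * (∫ u, Real.exp (-1 * u) ∂(pathKernel α lam r x)) +
        Real.exp (-x) ^ 2)) atTop (𝓝 (ε / 2)) := by
    have h2 := tendsto_integral_exp_pathKernel hα hlam hx (zero_lt_two' ℝ)
    have h1 := tendsto_integral_exp_pathKernel hα hlam hx (zero_lt_one' ℝ)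
    have h := (((h2.add (h1.const_mul (-2 * Real.exp (-x)))).add_const
      (Real.exp (-x) ^ 2)).const_mul D).const_add (ε / 2)
    rwa [← exp_neg_sub_sq, sub_self, zero_pow two_ne_zero, mul_zero, add_zero] at h
  filter_upwards [hlim.eventually_lt_const (half_lt_self hε), eventually_gt_atTop 0] with r hlt hr
  have := isMarkovKernel_pathKernel hα hlam hr
  have i1 := integrable_exp_pathKernel hα hlam hr hx (zero_lt_one' ℝ)
  have i2 := integrable_exp_pathKernel hα hlam hr hx (zero_lt_two' ℝ)
  obtain ⟨i3, e3⟩ := integral_exp_neg_sub_sq i1 i2 (Real.exp (-x))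
  rw [← e3] at hlt
  have hgi : Integrable g (pathKernel α lam r x) := g.integrable _
  have h1 : (∫ u, g u ∂(pathKernel α lam r x)) - g x =
      ∫ u, (g u - g x) ∂(pathKernel α lam r x) := by
    rw [integral_sub hgi (integrable_const _), integral_const, probReal_univ, one_smul]
  rw [Real.dist_eq, h1]
  refine lt_of_le_of_lt ?_ hlt
  have h2 : ∫ u, (ε / 2 + D * (Real.exp (-u) - Real.exp (-x)) ^ 2) ∂(pathKernel α lam r x) =
      ε / 2 + D * ∫ u, (Real.exp (-u) - Real.exp (-x)) ^ 2 ∂(pathKernel α lam r x) := by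
    rw [integral_add (integrable_const _) (i3.const_mul D), integral_const_mul, integral_const,
      probReal_univ, one_smul]
  rw [← h2]
  exact abs_integral_le_integral_abs.trans (integral_mono (hgi.sub (integrable_const _)).abs
    ((integrable_const _).add (i3.const_mul D)) hD)

lemma tendsto_integral_pathLaw (hα : 0 < α) (hlam : 0 < lam) (hμ : ∀ᵐ x ∂μ, 0 < x) (g : ℝ →ᵇ ℝ) :
    Tendsto (fun r => ∫ u, g u ∂(pathLaw α lam r μ)) atTop (𝓝 (∫ x, g x ∂μ)) := by
  have h : Tendsto (fun r => ∫ x, ∫ u, g u ∂(pathKernel α lam r x) ∂μ) atTop (𝓝 (∫ x, g x ∂μ)) := by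
    refine tendsto_integral_filter_of_dominated_convergence (fun _ => ‖g‖) ?_ ?_
      (integrable_const _) ?_
    · filter_upwards [eventually_gt_atTop 0] with r hr
      have := isMarkovKernel_pathKernel hα hlam hr
      exact (g.continuous.stronglyMeasurable.integral_kernel
        (κ := pathKernel α lam r)).aestronglyMeasurable
    · filter_upwards [eventually_gt_atTop 0] with r hr
      have := isMarkovKernel_pathKernel hα hlam hr
      refine ae_of_all _ fun x => ?_
      simpa using norm_integral_le_of_norm_le_const (μ := pathKernel α lam r x)
        (ae_of_all _ g.norm_coe_le_norm)
    · filter_upwards [hμ] with x hx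
      exact tendsto_integral_pathKernel hα hlam hx.le g
  refine h.congr' ?_
  filter_upwards [eventually_gt_atTop 0] with r hr
  have := isMarkovKernel_pathKernel hα hlam hr
  rw [pathLaw_eq_comp, Measure.comp_eq_comp_const_apply, Kernel.integral_comp (g.integrable _)]
  simp

/-- The Young inequality for the conjugate pair `klFun` and `exp - 1`. -/
lemma mul_le_klFun_add {t : ℝ} (ht : 0 < t) (y : ℝ) : t * y ≤ klFun t + (Real.exp y - 1) := by
  have h := mul_le_mul_of_nonneg_left (Real.add_one_le_exp (y - Real.log t)) ht.le
  have h2 : t * Real.exp (y - Real.log t) = Real.exp y := by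
    rw [Real.exp_sub, Real.exp_log ht]; field_simp
  rw [h2] at h
  rw [klFun_apply]
  linarith

/-- Lower semicontinuity at the final time: the entropies along the path bound that of `μ`. -/
lemma klDiv_le_of_pathEntropy_le (hα : 1 / 2 ≤ α) (hlam : 0 < lam) (hμ : ∀ᵐ x ∂μ, 0 < x)
    {E : ℝ≥0∞} (hE : ∀ r, 0 < r → pathEntropy α lam μ r ≤ E) :
    klDiv μ (gammaMeasure α lam) ≤ E := by
  have hα0 : 0 < α := by linarith
  have := isProbabilityMeasure_gammaMeasure hα0 hlam
  rcases eq_or_ne E ∞ with rfl | hE'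
  · exact le_top
  rw [← ENNReal.ofReal_toReal hE']
  refine klDiv_le_of_forall_boundedContinuous fun g => ?_
  refine le_of_tendsto (tendsto_integral_pathLaw hα0 hlam hμ g) ?_
  filter_upwards [eventually_gt_atTop 0] with r hr
  have hm := measurable_relDensity hα hlam hr hμ
  have hpos : ∀ᵐ u ∂(gammaMeasure α lam), 0 < relDensity α lam μ r u := by
    filter_upwards [gammaMeasure_ae_pos α lam] with u hu
    exact relDensity_pos hα hlam hr hμ hu.le
  have hk0 : 0 ≤ᵐ[gammaMeasure α lam] fun u => klFun (relDensity α lam μ r u) := by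
    filter_upwards [hpos] with u hu
    exact klFun_nonneg hu.le
  have hkm : AEStronglyMeasurable (fun u => klFun (relDensity α lam μ r u)) (gammaMeasure α lam) :=
    (measurable_klFun.comp hm).aestronglyMeasurable
  have hent := pathEntropy_eq_lintegral_gammaMeasure hα hlam hr hμ
  have hle := hE r hr
  rw [hent] at hle
  have hki : Integrable (fun u => klFun (relDensity α lam μ r u)) (gammaMeasure α lam) :=
    (lintegral_ofReal_ne_top_iff_integrable hkm hk0).1 (ne_top_of_le_ne_top hE' hle)
  have hei : Integrable (fun u => Real.exp (g u) - 1) (gammaMeasure α lam) := by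
    refine (Integrable.of_bound (g.continuous.rexp).aestronglyMeasurable (Real.exp ‖g‖)
      (ae_of_all _ fun u => ?_)).sub (integrable_const _)
    rw [Real.norm_eq_abs, Real.abs_exp]
    exact Real.exp_le_exp.2 ((le_abs_self _).trans (g.norm_coe_le_norm u))
  have hhi : Integrable (relDensity α lam μ r) (gammaMeasure α lam) := by
    refine (lintegral_ofReal_ne_top_iff_integrable hm.aestronglyMeasurable
      (hpos.mono fun u hu => hu.le)).1 ?_
    have h1 := isProbabilityMeasure_pathLaw hα0 hlam hr μ
    have h2 := measure_ne_top (pathLaw α lam r μ) univ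
    rwa [pathLaw_eq_withDensity_relDensity hα hlam hr hμ, withDensity_apply _ MeasurableSet.univ,
      Measure.restrict_univ] at h2
  have hhg : Integrable (fun u => relDensity α lam μ r u * g u) (gammaMeasure α lam) :=
    hhi.mul_bdd g.continuous.aestronglyMeasurable (ae_of_all _ g.norm_coe_le_norm)
  have h1 : ∫ u, g u ∂(pathLaw α lam r μ) =
      ∫ u, relDensity α lam μ r u * g u ∂(gammaMeasure α lam) := by
    rw [pathLaw_eq_withDensity_relDensity hα hlam hr hμ,
      integral_withDensity_eq_integral_toReal_smul hm.ennreal_ofReal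
        (ae_of_all _ fun u => ENNReal.ofReal_lt_top)]
    refine integral_congr_ae ?_
    filter_upwards [hpos] with u hu
    rw [ENNReal.toReal_ofReal hu.le, smul_eq_mul]
  have h2 : ∫ u, relDensity α lam μ r u * g u ∂(gammaMeasure α lam) ≤
      (∫ u, klFun (relDensity α lam μ r u) ∂(gammaMeasure α lam)) +
        ∫ u, (Real.exp (g u) - 1) ∂(gammaMeasure α lam) := by
    rw [← integral_add hki hei]
    refine integral_mono_ae hhg (hki.add hei) ?_
    filter_upwards [hpos] with u hu
    exact mul_le_klFun_add hu _
  have h3 : ∫ u, klFun (relDensity α lam μ r u) ∂(gammaMeasure α lam) ≤ E.toReal := by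
    rw [integral_eq_lintegral_of_nonneg_ae hk0 hkm]
    exact ENNReal.toReal_mono hE' hle
  linarith

end

/-! ### The Fisher information along the path -/

section

variable {μ : Measure ℝ} [IsProbabilityMeasure μ] {α lam : ℝ}

lemma hasDerivAt_pathDensity (hα : 1 / 2 ≤ α) (hlam : 0 < lam) {r : ℝ} (hr : 0 < r)
    (hμ : ∀ᵐ x ∂μ, 0 < x) {u : ℝ} (hu : 0 < u) :
    HasDerivAt (fun u => gammaPDFReal α lam u * relDensity α lam μ r u)
      (gammaScore α lam u * gammaPDFReal α lam u * relDensity α lam μ r u +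
        gammaPDFReal α lam u * relDensity' α lam μ r u) u :=
  (hasDerivAt_gammaPDFReal α lam hu).mul (hasDerivAt_relDensity_space hα hlam hr hμ u)

/-- The density of the path is continuously differentiable on `(0, ∞)`, hence Lipschitz on compact
intervals. -/
lemma isRegularDensity_pathLaw (hα : 1 / 2 ≤ α) (hlam : 0 < lam) {r : ℝ} (hr : 0 < r)
    (hμ : ∀ᵐ x ∂μ, 0 < x) :
    IsRegularDensity (fun u => gammaPDFReal α lam u * relDensity α lam μ r u)
      (pathLaw α lam r μ) := by
  have hα0 : 0 < α := by linarith
  have hm := (measurable_relDensity hα hlam hr hμ).ennreal_ofReal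
  refine ⟨fun u hu => mul_nonneg (gammaPDFReal_nonneg hα0 hlam u)
    (relDensity_pos hα hlam hr hμ hu.le).le, fun a b ha hab => ?_, ?_⟩
  · have hsub : Icc a b ⊆ Ioi 0 := fun u hu => ha.trans_le hu.1
    have c0 : ContinuousOn (relDensity α lam μ r) (Icc a b) := fun u _ =>
      (hasDerivAt_relDensity_space hα hlam hr hμ u).continuousAt.continuousWithinAt
    have c1 : ContinuousOn (relDensity' α lam μ r) (Icc a b) := fun u _ =>
      (hasDerivAt_relDensity'_space hα hlam hr hμ u).continuousAt.continuousWithinAt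
    have cg := (continuousOn_gammaPDFReal α lam).mono hsub
    have cs : ContinuousOn (gammaScore α lam) (Icc a b) :=
      (continuousOn_const.div continuousOn_id fun u hu => (hsub hu).ne').sub continuousOn_const
    have cd := ((cs.mul cg).mul c0).add (cg.mul c1)
    obtain ⟨C, hC⟩ := isCompact_Icc.exists_bound_of_continuousOn cd
    have hL := (convex_Icc a b).lipschitzOnWith_of_nnnorm_hasDerivWithin_le (C := C.toNNReal)
      (fun u hu => (hasDerivAt_pathDensity hα hlam hr hμ (hsub hu)).hasDerivWithinAt)
      (fun u hu => by
        rw [← NNReal.coe_le_coe, coe_nnnorm]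
        exact (hC u hu).trans (Real.le_coe_toNNReal C))
    rw [← uIcc_of_le hab] at hL
    exact hL.absolutelyContinuousOnInterval
  · ext A hA
    rw [pathLaw_eq_withDensity_relDensity hα hlam hr hμ, withDensity_apply _ hA,
      withDensity_apply _ hA, ← lintegral_indicator hA, ← lintegral_indicator hA,
      lintegral_gammaMeasure _ (hm.indicator hA).aemeasurable]
    refine lintegral_congr fun u => ?_
    by_cases hu : u ∈ A
    · simp [hu, ENNReal.ofReal_mul (gammaPDFReal_nonneg hα0 hlam u)]
    · simp [hu]

/-- The score of the path relative to the gamma score is the logarithmic derivative of the relative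
density, so that the standardized Fisher information is the entropy production up to the time
change. -/
lemma relFisherInfo_pathLaw (hα : 1 / 2 ≤ α) (hlam : 0 < lam) {r : ℝ} (hr : 0 < r)
    (hμ : ∀ᵐ x ∂μ, 0 < x) : relFisherInfo α lam (pathLaw α lam r μ) =
      ENNReal.ofReal (r * (r + lam)) *
        ∫⁻ u in Ioi (0 : ℝ), ENNReal.ofReal (production α lam μ r u) := by
  have hα0 : 0 < α := by linarith
  have hreg := isRegularDensity_pathLaw hα hlam hr hμ
  have := isProbabilityMeasure_pathLaw hα0 hlam hr μ
  have hfm : Measurable fun u => ENNReal.ofReal (gammaPDFReal α lam u * relDensity α lam μ r u) :=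
    ((measurable_gammaPDFReal α lam).mul (measurable_relDensity hα hlam hr hμ)).ennreal_ofReal
  rw [relFisherInfo_eq hreg, fisherOfDensity, hreg.eq_withDensity,
    lintegral_withDensity_eq_lintegral_mul_non_measurable _ hfm
      (ae_of_all _ fun u => ENNReal.ofReal_lt_top),
    ← lintegral_const_mul' _ _ ENNReal.ofReal_ne_top]
  refine setLIntegral_congr_fun measurableSet_Ioi fun u (hu : 0 < u) => ?_
  have hg := gammaPDFReal_pos hα0 hlam hu
  have hh := relDensity_pos hα hlam hr hμ hu.le
  have hscore : score (fun u => gammaPDFReal α lam u * relDensity α lam μ r u) u -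
      gammaScore α lam u = relDensity' α lam μ r u / relDensity α lam μ r u := by
    rw [score, ((hasDerivAt_pathDensity hα hlam hr hμ hu).log (mul_pos hg hh).ne').deriv]
    field_simp
    ring
  simp only [Pi.mul_apply]
  rw [hscore, ← ENNReal.ofReal_mul (mul_pos hg hh).le, ← ENNReal.ofReal_mul (by positivity),
    production]
  congr 1
  field_simp

/-- The total entropy production over all times is the relative entropy of `μ`. -/
lemma lintegral_production_eq_klDiv (hα : 1 / 2 ≤ α) (hlam : 0 < lam) (hμ : ∀ᵐ x ∂μ, 0 < x)
    (hint : Integrable (fun x => x ^ (α + 4)) μ) :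
    ∫⁻ r in Ioi (0 : ℝ), ∫⁻ u in Ioi (0 : ℝ), ENNReal.ofReal (production α lam μ r u) =
      klDiv μ (gammaMeasure α lam) := by
  refine le_antisymm ?_ ?_
  · refine le_of_tendsto' (tendsto_lintegral_Ioc _) fun n => ?_
    have hn : (0 : ℝ) ≤ n := n.cast_nonneg
    have h1 : 1 / ((n : ℝ) + 1) ≤ n + 1 := by rw [div_le_iff₀ (by positivity)]; nlinarith
    refine le_trans ?_ (pathEntropy_le_klDiv hα hlam (by positivity : 0 < (n : ℝ) + 1) hμ)
    rw [pathEntropy_eq_add hα hlam hμ hint (by positivity : 0 < 1 / ((n : ℝ) + 1)) h1]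
    exact le_add_self
  · refine klDiv_le_of_pathEntropy_le hα hlam hμ fun r hr => ?_
    have h1 := (tendsto_pathEntropy_zero hα hlam hμ hint).add_const
      (∫⁻ r in Ioi (0 : ℝ), ∫⁻ u in Ioi (0 : ℝ), ENNReal.ofReal (production α lam μ r u))
    rw [zero_add] at h1
    refine ge_of_tendsto h1 ?_
    filter_upwards [Ioc_mem_nhdsGT hr] with a ha
    rw [pathEntropy_eq_add hα hlam hμ hint ha.1 ha.2]
    gcongr
    exact fun x hx => ha.1.trans hx.1

lemma hasDerivAt_timeChange (lam : ℝ) {τ : ℝ} (hτ : τ < 1) :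
    HasDerivAt (fun τ => lam * τ / (1 - τ)) (lam / (1 - τ) ^ 2) τ := by
  have h : 1 - τ ≠ 0 := by linarith
  refine (((hasDerivAt_id τ).const_mul lam).div ((hasDerivAt_id τ).const_sub 1) h).congr_deriv ?_
  simp only [id]
  field_simp
  ring

lemma image_timeChange (hlam : 0 < lam) :
    (fun τ => lam * τ / (1 - τ)) '' Ioo (0 : ℝ) 1 = Ioi 0 := by
  ext r
  constructor
  · rintro ⟨τ, ⟨h0, h1⟩, rfl⟩
    have : 0 < 1 - τ := by linarith
    exact div_pos (mul_pos hlam h0) this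
  · intro (hr : 0 < r)
    refine ⟨r / (r + lam), ⟨by positivity, (div_lt_one (by positivity)).2 (by linarith)⟩, ?_⟩
    have h2 : 1 - r / (r + lam) = lam / (r + lam) := by field_simp; ring
    simp only [h2]
    field_simp

lemma injOn_timeChange (hlam : 0 < lam) : InjOn (fun τ => lam * τ / (1 - τ)) (Ioo (0 : ℝ) 1) := by
  intro τ hτ σ hσ h
  have h1 : 1 - τ ≠ 0 := by linarith [hτ.2]
  have h2 : 1 - σ ≠ 0 := by linarith [hσ.2]
  simp only at h
  rw [div_eq_div_iff h1 h2] at h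
  have : lam * (τ - σ) = 0 := by linarith
  rcases mul_eq_zero.1 this with h3 | h3 <;> linarith

/-- The integral representation of the relative entropy along the gamma smart path, for the law `μ`
of the variable. -/
lemma klDiv_eq_lintegral_relFisherInfo (hα : 1 / 2 ≤ α) (hlam : 0 < lam) (hμ : ∀ᵐ x ∂μ, 0 < x)
    (hint : Integrable (fun x => x ^ (α + 4)) μ) :
    klDiv μ (gammaMeasure α lam) = ∫⁻ τ in Ioo (0 : ℝ) 1,
      ENNReal.ofReal (1 / (lam * τ)) * relFisherInfo α lam (law α lam τ μ) := by
  rw [← lintegral_production_eq_klDiv hα hlam hμ hint, ← image_timeChange hlam,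
    lintegral_image_eq_lintegral_abs_deriv_mul measurableSet_Ioo
      (fun τ hτ => (hasDerivAt_timeChange lam hτ.2).hasDerivWithinAt) (injOn_timeChange hlam)]
  refine setLIntegral_congr_fun measurableSet_Ioo fun τ hτ => ?_
  have h0 : 0 < τ := hτ.1
  have h1 : 0 < 1 - τ := sub_pos.2 hτ.2
  rw [law_eq_pathLaw (by linarith) hlam h0 hτ.2, relFisherInfo_pathLaw hα hlam (by positivity) hμ,
    ← mul_assoc, ← ENNReal.ofReal_mul (by positivity), abs_of_pos (by positivity),
    image_timeChange hlam]
  congr 2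
  field_simp
  ring

end

end GammaSmartPath

end

theorem mainTheorem2 {Ω : Type*} [MeasurableSpace Ω] (P : Measure Ω) [IsProbabilityMeasure P]
    (α lam : ℝ) (hα : 1 / 2 ≤ α) (hlam : 0 < lam)
    (X : Ω → ℝ) (hX : AEMeasurable X P) (hpos : ∀ᵐ ω ∂P, 0 < X ω)
    (hmom : Integrable (fun ω => X ω ^ (α + 4)) P)
    (hmean : ∫ ω, X ω ∂P = α / lam) :
    InformationTheory.klDiv (P.map X) (gammaMeasure α lam) =
      ∫⁻ τ in Ioo (0 : ℝ) 1, ENNReal.ofReal (1 / (lam * τ)) *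
        GammaSmartPath.relFisherInfo α lam (GammaSmartPath.law α lam τ (P.map X)) := by
  have := Measure.isProbabilityMeasure_map (μ := P) hX
  refine GammaSmartPath.klDiv_eq_lintegral_relFisherInfo hα hlam
    ((ae_map_iff hX measurableSet_Ioi).2 hpos) ?_
  exact (integrable_map_measure
    (f := X) (g := fun x : ℝ => x ^ (α + 4)) (by fun_prop) hX).2 hmom
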